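/- Let $A\in M_n(\mathbb R)$ and $B\in M_{n,m}(\mathbb R)$ be such that $B$ has rank $m$ and the Kalman condition $\operatorname{span}\{B,AB,\dots,A^{n-1}B\}=\mathbb R^n$ holds. Consider the costs $c(x,u)=x^\top Qx+2x^\top Su+u^\top Ru$ with $Q$ symmetric, $R$ symmetric positive definite, and such that the Hamiltonian matrix $$\begin{pmatrix}A-BR^{-1}S^\top & BR^{-1}B^\top\\ Q-SR^{-1}S^\top & -A^\top+SR^{-1}B^\top\end{pmatrix}$$ has no eigenvalue on the imaginary axis. The optimal synthesis of $c$ is the set of all trajectories $x$ of $\dot x=Ax+Bu$ (with square-integrable controls $u$), on all intervals $[t_0,t_1]$ with $t_0<t_1$, which minimize $\int_{t_0}^{t_1}c(x,u)\,dt$ among the trajectories with the same end points. The pair $(A_+,A_-)$ attached to $c$ (which characterizes its synthesis) is given by $A_\pm=A-BR^{-1}(S^\top+B^\top P_\pm)$, where $P_+$ (resp. $P_-$) is the symmetric solution of the algebraic Riccati equation $PA+A^\top P-(S+PB)R^{-1}(S^\top+B^\top P)+Q=0$ for which all eigenvalues of $A_+$ have negative real part (resp. all eigenvalues of $A_-$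 have positive real part). Let $\mathcal J\subset M_n(\mathbb R)^2$, with the induced topology, be the set of all pairs $(A_+,A_-)$ attached to such costs ($A$ and $B$ being fixed), and let $\mathcal J_p$ be the set of the pairs $(A_+,A_-)\in\mathcal J$ for which there is a decomposition $\mathbb R^n=E_1\oplus E_2$ with $E_1,E_2\neq\{0\}$ such that $A_+$ and $A_-$ both leave $E_1$ and $E_2$ invariant. Then $\mathcal J\setminus\mathcal J_p$ contains an open and dense subset of $\mathcal J$. Moreover the inverse problem is injective on $\mathcal J\setminus\mathcal J_p$ (so that injectivity is generic): if the pair attached to a cost $c$ as above belongs to $\mathcal J\setminus\mathcal J_p$, then there is exactly one canonical cost, that is, a cost $(u+Kx)^\top R'(u+Kx)$ with $R'$ symmetric positive definite, $\det R'=1$, and all eigenvalues of $A-BK$ of negative real part, which has the same optimal synthesis as $c$. -/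

import Mathlib

open scoped Matrix

namespace LQ

noncomputable section

/-- The standing hypotheses on the dynamics `x' = A x + B u`: the matrix `B` has rank `m`, and
`(A, B)` satisfies the Kalman controllability condition, that is, the columns of
`B, A B, …, A ^ (n - 1) B` span `ℝⁿ`. -/
structure IsControllablePair {n m : ℕ} (A : Matrix (Fin n) (Fin n) ℝ)
    (B : Matrix (Fin n) (Fin m) ℝ) : Prop where
  rank_eq : B.rank = m
  kalman : Submodule.span ℝ
    {w : Fin n → ℝ | ∃ i < n, ∃ v : Fin m → ℝ, w = (A ^ i * B) *ᵥ v} = ⊤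

/-- All the complex eigenvalues of the real matrix `M` have negative real part. -/
def IsAsympStable {n : ℕ} (M : Matrix (Fin n) (Fin n) ℝ) : Prop :=
  ∀ z ∈ spectrum ℂ (M.map (algebraMap ℝ ℂ)), z.re < 0

/-- All the complex eigenvalues of the real matrix `M` have positive real part. -/
def IsAsympAntistable {n : ℕ} (M : Matrix (Fin n) (Fin n) ℝ) : Prop :=
  ∀ z ∈ spectrum ℂ (M.map (algebraMap ℝ ℂ)), 0 < z.re

/-- The Hamiltonian matrix of the LQ problem `(A, B, Q, S, R)`. -/
def hamiltonian {n m : ℕ} (A : Matrix (Fin n) (Fin n) ℝ) (B : Matrix (Fin n) (Fin m) ℝ)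
    (Q : Matrix (Fin n) (Fin n) ℝ) (S : Matrix (Fin n) (Fin m) ℝ)
    (R : Matrix (Fin m) (Fin m) ℝ) : Matrix (Fin n ⊕ Fin n) (Fin n ⊕ Fin n) ℝ :=
  Matrix.fromBlocks (A - B * R⁻¹ * Sᵀ) (B * R⁻¹ * Bᵀ)
    (Q - S * R⁻¹ * Sᵀ) (-Aᵀ + S * R⁻¹ * Bᵀ)

/-- The standing hypotheses on the quadratic cost: `Q` and `R` are symmetric, `R` is positive
definite (for real matrices `Matrix.PosDef` includes symmetry), and the Hamiltonian matrix has no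
eigenvalue on the imaginary axis. -/
structure IsAdmissibleCost {n m : ℕ} (A : Matrix (Fin n) (Fin n) ℝ)
    (B : Matrix (Fin n) (Fin m) ℝ) (Q : Matrix (Fin n) (Fin n) ℝ)
    (S : Matrix (Fin n) (Fin m) ℝ) (R : Matrix (Fin m) (Fin m) ℝ) : Prop where
  symm : Q.IsSymm
  posDef : R.PosDef
  hamiltonian_re_ne_zero :
    ∀ z ∈ spectrum ℂ ((hamiltonian A B Q S R).map (algebraMap ℝ ℂ)), z.re ≠ 0

/-- `P` is a symmetric solution of the algebraic Riccati equation. -/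
def IsRiccatiSolution {n m : ℕ} (A : Matrix (Fin n) (Fin n) ℝ) (B : Matrix (Fin n) (Fin m) ℝ)
    (Q : Matrix (Fin n) (Fin n) ℝ) (S : Matrix (Fin n) (Fin m) ℝ)
    (R : Matrix (Fin m) (Fin m) ℝ) (P : Matrix (Fin n) (Fin n) ℝ) : Prop :=
  P.IsSymm ∧ P * A + Aᵀ * P - (S + P * B) * R⁻¹ * (Sᵀ + Bᵀ * P) + Q = 0

/-- The closed-loop matrix `A - B R⁻¹ (Sᵀ + Bᵀ P)`. -/
def closedLoop {n m : ℕ} (A : Matrix (Fin n) (Fin n) ℝ) (B : Matrix (Fin n) (Fin m) ℝ)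
    (S : Matrix (Fin n) (Fin m) ℝ) (R : Matrix (Fin m) (Fin m) ℝ)
    (P : Matrix (Fin n) (Fin n) ℝ) : Matrix (Fin n) (Fin n) ℝ :=
  A - B * R⁻¹ * (Sᵀ + Bᵀ * P)

/-- `(Aplus, Aminus)` is the pair of matrices attached to the LQ problem `(A, B, Q, S, R)`:
`Aplus` (resp. `Aminus`) is the closed-loop matrix of the symmetric solution of the algebraic
Riccati equation which makes this closed-loop matrix asymptotically stable (resp. anti-stable). -/
def IsSynthesisPair {n m : ℕ} (A : Matrix (Fin n) (Fin n) ℝ) (B : Matrix (Fin n) (Fin m) ℝ)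
    (Q : Matrix (Fin n) (Fin n) ℝ) (S : Matrix (Fin n) (Fin m) ℝ)
    (R : Matrix (Fin m) (Fin m) ℝ) (Aplus Aminus : Matrix (Fin n) (Fin n) ℝ) : Prop :=
  (∃ P, IsRiccatiSolution A B Q S R P ∧ Aplus = closedLoop A B S R P ∧ IsAsympStable Aplus) ∧
  (∃ P, IsRiccatiSolution A B Q S R P ∧ Aminus = closedLoop A B S R P ∧ IsAsympAntistable Aminus)

/-- The set `𝒥` of the pairs `(A₊, A₋)` which arise from the autonomous LQ problems with
dynamics `(A, B)`. -/
def synthesisPairs {n m : ℕ} (A : Matrix (Fin n) (Fin n) ℝ) (B : Matrix (Fin n) (Fin m) ℝ) :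
    Set (Matrix (Fin n) (Fin n) ℝ × Matrix (Fin n) (Fin n) ℝ) :=
  {p | ∃ (Q : Matrix (Fin n) (Fin n) ℝ) (S : Matrix (Fin n) (Fin m) ℝ)
    (R : Matrix (Fin m) (Fin m) ℝ),
    IsAdmissibleCost A B Q S R ∧ IsSynthesisPair A B Q S R p.1 p.2}

/-- The linear map of matrix `M` leaves the subspace `E` invariant. -/
def LeavesInvariant {n : ℕ} (M : Matrix (Fin n) (Fin n) ℝ) (E : Submodule ℝ (Fin n → ℝ)) : Prop :=
  ∀ v ∈ E, M *ᵥ v ∈ E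

/-- The set `𝒥ₚ` of the pairs of `𝒥` both of whose members leave invariant both summands of
one and the same decomposition `ℝⁿ = E₁ ⊕ E₂` with `E₁, E₂ ≠ 0`. -/
def productPairs {n m : ℕ} (A : Matrix (Fin n) (Fin n) ℝ) (B : Matrix (Fin n) (Fin m) ℝ) :
    Set (Matrix (Fin n) (Fin n) ℝ × Matrix (Fin n) (Fin n) ℝ) :=
  {p | p ∈ synthesisPairs A B ∧ ∃ E₁ E₂ : Submodule ℝ (Fin n → ℝ),
    IsCompl E₁ E₂ ∧ E₁ ≠ ⊥ ∧ E₂ ≠ ⊥ ∧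
    LeavesInvariant p.1 E₁ ∧ LeavesInvariant p.1 E₂ ∧
    LeavesInvariant p.2 E₁ ∧ LeavesInvariant p.2 E₂}

/-- The quadratic cost `xᵀ Q x + 2 xᵀ S u + uᵀ R u`. -/
def quadraticCost {n m : ℕ} (Q : Matrix (Fin n) (Fin n) ℝ) (S : Matrix (Fin n) (Fin m) ℝ)
    (R : Matrix (Fin m) (Fin m) ℝ) (x : Fin n → ℝ) (u : Fin m → ℝ) : ℝ :=
  x ⬝ᵥ (Q *ᵥ x) + 2 * (x ⬝ᵥ (S *ᵥ u)) + u ⬝ᵥ (R *ᵥ u)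

/-- The canonical cost `(u + K x)ᵀ R (u + K x)`. -/
def canonicalCost {n m : ℕ} (K : Matrix (Fin m) (Fin n) ℝ) (R : Matrix (Fin m) (Fin m) ℝ)
    (x : Fin n → ℝ) (u : Fin m → ℝ) : ℝ :=
  (u + K *ᵥ x) ⬝ᵥ (R *ᵥ (u + K *ᵥ x))

/-- The data of a canonical cost: `R` is symmetric positive definite with `det R = 1`, and `K` is
stabilizing. -/
structure IsCanonical {n m : ℕ} (A : Matrix (Fin n) (Fin n) ℝ) (B : Matrix (Fin n) (Fin m) ℝ)
    (K : Matrix (Fin m) (Fin n) ℝ) (R : Matrix (Fin m) (Fin m) ℝ) : Prop where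
  posDef : R.PosDef
  det_eq_one : R.det = 1
  stable : IsAsympStable (A - B * K)

/-- `x` is, on `[t₀, t₁]`, the trajectory of `x' = A x + B u` for the square-integrable control
`u` (the equation is written in integral form). -/
structure IsTrajectory {n m : ℕ} (A : Matrix (Fin n) (Fin n) ℝ) (B : Matrix (Fin n) (Fin m) ℝ)
    (t₀ t₁ : ℝ) (x : ℝ → Fin n → ℝ) (u : ℝ → Fin m → ℝ) : Prop where
  continuousOn : ContinuousOn x (Set.Icc t₀ t₁)
  memLp : MeasureTheory.MemLp u 2 (MeasureTheory.volume.restrict (Set.Icc t₀ t₁))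
  eq_integral : ∀ t ∈ Set.Icc t₀ t₁, x t = x t₀ + ∫ s in t₀..t, (A *ᵥ x s + B *ᵥ u s)

/-- `x` is a minimizing trajectory on `[t₀, t₁]` of the LQ problem with cost `c`, among all the
trajectories with the same end points. -/
def IsMinimizing {n m : ℕ} (A : Matrix (Fin n) (Fin n) ℝ) (B : Matrix (Fin n) (Fin m) ℝ)
    (c : (Fin n → ℝ) → (Fin m → ℝ) → ℝ) (t₀ t₁ : ℝ) (x : ℝ → Fin n → ℝ) : Prop :=
  ∃ u : ℝ → Fin m → ℝ, IsTrajectory A B t₀ t₁ x u ∧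
    ∀ (y : ℝ → Fin n → ℝ) (v : ℝ → Fin m → ℝ), IsTrajectory A B t₀ t₁ y v →
      y t₀ = x t₀ → y t₁ = x t₁ →
      ∫ t in t₀..t₁, c (x t) (u t) ≤ ∫ t in t₀..t₁, c (y t) (v t)

/-- The optimal synthesis of the cost `c`: all its minimizing trajectories, for all time intervals
`[t₀, t₁]` with `t₀ < t₁` and all end points. The values of `x` outside `[t₀, t₁]` are
unconstrained, so that two syntheses are equal if and only if they consist of the same
trajectories. -/
def optimalSynthesis {n m : ℕ} (A : Matrix (Fin n) (Fin n) ℝ) (B : Matrix (Fin n) (Fin m) ℝ)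
    (c : (Fin n → ℝ) → (Fin m → ℝ) → ℝ) : Set (ℝ × ℝ × (ℝ → Fin n → ℝ)) :=
  {τ | τ.1 < τ.2.1 ∧ IsMinimizing A B c τ.1 τ.2.1 τ.2.2}

end

end LQ

/-!
Fix a controllable pair `(A, B)`, and write `F = A - B K` and `W = B R⁻¹ Bᵀ` for a canonical cost of
data `(K, R)`.

**Injectivity.** Completing the square with the stabilizing solution of the Riccati equation turns a
quadratic cost into a canonical one, up to a function of the end points and a positive factor,
which normalizes `det R` (`optimalSynthesis_quadraticCost`). This gives existence.

For uniqueness, the minimizing trajectories of a canonical cost are the states of the solutions of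
the linear Hamiltonian system `x' = F x + W p`, `p' = -Fᵀ p`: such a state is minimizing
(`IsExtremal.isMinimizing`), it is the only minimizer with its end points
(`IsExtremal.eqOn_of_isMinimizing`), and any two end points are joined by one (`exists_extremal`).
As the state observes the Hamiltonian system, two canonical costs with the same synthesis have
Hamiltonian systems intertwined by a linear map which preserves the state. Its lower left block
solves a homogeneous Lyapunov equation, hence is zero; it follows that `K₁ = K₂`, and that the
transpose `N` of the lower right block commutes with `F` and satisfies `N B = B R₁⁻¹ R₂`
(`eq_and_exists_intertwiner`). The matrix `X = (P₋ - P₊)⁻¹` is the solution of the Lyapunov equation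
`F X + X Fᵀ = W₁`, and both `N X` and `X Nᵀ` solve the equation of right-hand side
`N W₁ = W₁ Nᵀ`. Hence `N X = X Nᵀ`, and `N` commutes with `A₋ = F - W₁ X⁻¹` as well. Moreover `N` is
semisimple with real eigenvalues, as `R₁⁻¹ R₂` is. If `N` is not a scalar, an eigenspace of `N` and
its complement decompose `(A₊, A₋)`; if it is, `R₂` is proportional to `R₁`, and `det R₁ = det R₂`
gives equality (`eq_smul_or_exists_isCompl`).

**Genericity.** Call a pair rigid if only the scalars commute with both members. Rigidity is an open
condition, as the injectivity of a linear map (`isOpen_isRigidPair`), and it excludes a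
decomposition, the projections of which commute with both members
(`IsRigidPair.notMem_productPairs`). The pairs attached to costs are exactly the
`(F, F - W X⁻¹)` with `F = A - B K` stable, `W = B V Bᵀ`, `V = R⁻¹` positive definite and
`F X + X Fᵀ = W` (`exists_lyapunov_of_mem_synthesisPairs`, `mem_synthesisPairs_of_lyapunov`), and
they depend continuously on `(K, V)`. For density, choose `v` with `B v ≠ 0`. By Heymann's lemma
(`exists_feedback_det_ne_zero`), `b = B v` is a cyclic vector of `A - B K` for some `K`, hence for
most `K`, so that a small perturbation of the feedback achieves this. Then the single-input pair
with `W = b bᵀ` is rigid, and `V + s v vᵀ` yields a rigid pair for all but finitely many `s > 0`: up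
to an auxiliary unknown, the equations of the commutant are linear and affine in `s`, with an
injective coefficient of `s` (`eventually_isRigidPair`).
-/

namespace LQ

variable {n m : ℕ}

/-! ### Spectra and Sylvester equations -/

theorem mem_spectrum_map_iff {M : Matrix (Fin n) (Fin n) ℝ} {z : ℂ} :
    z ∈ spectrum ℂ (M.map (algebraMap ℝ ℂ)) ↔ Polynomial.aeval z M.charpoly = 0 := by
  rw [Matrix.mem_spectrum_iff_isRoot_charpoly, Matrix.charpoly_map, Polynomial.IsRoot.def,
    Polynomial.eval_map_algebraMap]

theorem spectrum_map_transpose (M : Matrix (Fin n) (Fin n) ℝ) :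
    spectrum ℂ (Mᵀ.map (algebraMap ℝ ℂ)) = spectrum ℂ (M.map (algebraMap ℝ ℂ)) := by
  ext z
  rw [mem_spectrum_map_iff, mem_spectrum_map_iff, Matrix.charpoly_transpose]

theorem spectrum_map_neg (M : Matrix (Fin n) (Fin n) ℝ) :
    spectrum ℂ ((-M).map (algebraMap ℝ ℂ)) = -spectrum ℂ (M.map (algebraMap ℝ ℂ)) := by
  rw [spectrum.neg_eq]
  congr 1
  ext i j
  simp

theorem IsAsympStable.transpose {M : Matrix (Fin n) (Fin n) ℝ} (h : IsAsympStable M) :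
    IsAsympStable Mᵀ := by
  intro z hz
  rw [spectrum_map_transpose] at hz
  exact h z hz

theorem IsAsympStable.neg {M : Matrix (Fin n) (Fin n) ℝ} (h : IsAsympStable M) :
    IsAsympAntistable (-M) := by
  intro z hz
  rw [spectrum_map_neg, Set.mem_neg] at hz
  have := h _ hz
  simpa using this

/-- The homogeneous Sylvester equation `M Y = Y M'` has only the trivial solution when the spectra
of `M` and `M'` are disjoint: a Bézout relation between the two characteristic polynomials makes
`Y` vanish. -/
theorem eq_zero_of_mul_eq_mul {k : ℕ} {M : Matrix (Fin n) (Fin n) ℝ}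
    {M' : Matrix (Fin k) (Fin k) ℝ}
    {Y : Matrix (Fin n) (Fin k) ℝ}
    (hM : ∀ z, z ∈ spectrum ℂ (M.map (algebraMap ℝ ℂ)) →
      z ∉ spectrum ℂ (M'.map (algebraMap ℝ ℂ)))
    (hY : M * Y = Y * M') : Y = 0 := by
  have hcop : IsCoprime M.charpoly M'.charpoly := by
    rw [Polynomial.isCoprime_iff_aeval_ne_zero_of_isAlgClosed ℝ ℂ]
    intro z
    by_contra! h
    exact hM z (mem_spectrum_map_iff.2 h.1) (mem_spectrum_map_iff.2 h.2)
  have hpow : ∀ j : ℕ, M ^ j * Y = Y * M' ^ j := by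
    intro j
    induction j with
    | zero => simp
    | succ j ih => rw [pow_succ, Matrix.mul_assoc, hY, ← Matrix.mul_assoc, ih, Matrix.mul_assoc,
        ← pow_succ]
  have hpoly : ∀ q : Polynomial ℝ, Polynomial.aeval M q * Y = Y * Polynomial.aeval M' q := by
    intro q
    simp only [Polynomial.aeval_eq_sum_range, Matrix.sum_mul, Matrix.mul_sum, Matrix.smul_mul,
      Matrix.mul_smul, hpow]
  obtain ⟨a, b, hab⟩ := hcop
  have h1 := congrArg (Polynomial.aeval M') hab
  rw [map_add, map_mul, map_mul, Matrix.aeval_self_charpoly, mul_zero, add_zero, map_one] at h1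
  calc Y = Y * (Polynomial.aeval M' a * Polynomial.aeval M' M.charpoly) := by
        rw [h1, Matrix.mul_one]
    _ = Y * Polynomial.aeval M' (M.charpoly * a) := by rw [← map_mul, mul_comm]
    _ = Polynomial.aeval M (M.charpoly * a) * Y := (hpoly _).symm
    _ = 0 := by rw [map_mul, Matrix.aeval_self_charpoly, zero_mul, Matrix.zero_mul]

/-- Two matrices with disjoint spectra do not have the same orbit. -/
theorem eq_zero_of_pow_mulVec_eq {M M' : Matrix (Fin n) (Fin n) ℝ}
    (hM : ∀ z, z ∈ spectrum ℂ (M.map (algebraMap ℝ ℂ)) →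
      z ∉ spectrum ℂ (M'.map (algebraMap ℝ ℂ)))
    {v : Fin n → ℝ} (hv : ∀ k : ℕ, M ^ k *ᵥ v = M' ^ k *ᵥ v) : v = 0 := by
  have hcop : IsCoprime M.charpoly M'.charpoly := by
    rw [Polynomial.isCoprime_iff_aeval_ne_zero_of_isAlgClosed ℝ ℂ]
    intro z
    by_contra! h
    exact hM z (mem_spectrum_map_iff.2 h.1) (mem_spectrum_map_iff.2 h.2)
  have hpoly : ∀ q : Polynomial ℝ, Polynomial.aeval M q *ᵥ v = Polynomial.aeval M' q *ᵥ v := by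
    intro q
    simp only [Polynomial.aeval_eq_sum_range, Matrix.sum_mulVec, Matrix.smul_mulVec, hv]
  obtain ⟨a, b, hab⟩ := hcop
  calc v = Polynomial.aeval M (a * M.charpoly + b * M'.charpoly) *ᵥ v := by
        rw [hab, map_one, Matrix.one_mulVec]
    _ = Polynomial.aeval M b *ᵥ (Polynomial.aeval M M'.charpoly *ᵥ v) := by
        rw [map_add, map_mul, map_mul, Matrix.aeval_self_charpoly, mul_zero, zero_add,
          Matrix.mulVec_mulVec]
    _ = 0 := by
        rw [hpoly, Matrix.aeval_self_charpoly, Matrix.zero_mulVec, Matrix.mulVec_zero]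

/-- For stable `F`, `F'`, the Lyapunov-type operator `Y ↦ F Y + Y F'` is injective. -/
theorem eq_zero_of_lyapunov {F F' Y : Matrix (Fin n) (Fin n) ℝ} (hF : IsAsympStable F)
    (hF' : IsAsympStable F') (h : F * Y + Y * F' = 0) : Y = 0 := by
  refine eq_zero_of_mul_eq_mul (M := F) (M' := -F') (fun z hz hz' => ?_) ?_
  · exact lt_asymm (hF z hz) (hF'.neg z hz')
  · rw [Matrix.mul_neg]
    exact eq_neg_of_add_eq_zero_left h

/-! ### Controllability -/

/-- Controllability of the pair `(F, B)` in dual form: no nonzero row vector annihilates all the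
matrices `F ^ k B`. -/
def IsReachable {m : ℕ} (F : Matrix (Fin n) (Fin n) ℝ) (B : Matrix (Fin n) (Fin m) ℝ) : Prop :=
  ∀ p : Fin n → ℝ, (∀ k : ℕ, p ᵥ* (F ^ k * B) = 0) → p = 0

theorem IsControllablePair.isReachable {A : Matrix (Fin n) (Fin n) ℝ}
    {B : Matrix (Fin n) (Fin m) ℝ} (hAB : IsControllablePair A B) : IsReachable A B := by
  intro p hp
  have h : ∀ w : Fin n → ℝ, p ⬝ᵥ w = 0 := by
    intro w
    have hw : w ∈ Submodule.span ℝ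
        {w : Fin n → ℝ | ∃ i < n, ∃ v : Fin m → ℝ, w = (A ^ i * B) *ᵥ v} := by
      rw [hAB.kalman]; trivial
    induction hw using Submodule.span_induction with
    | mem w hw =>
      obtain ⟨i, -, v, rfl⟩ := hw
      rw [Matrix.dotProduct_mulVec, hp, zero_dotProduct]
    | zero => simp
    | add x y _ _ hx hy => rw [dotProduct_add, hx, hy, add_zero]
    | smul a x _ hx => rw [dotProduct_smul, hx, smul_zero]
  exact dotProduct_eq_zero p h

theorem IsReachable.feedback {A : Matrix (Fin n) (Fin n) ℝ} {B : Matrix (Fin n) (Fin m) ℝ}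
    (h : IsReachable A B) (K : Matrix (Fin m) (Fin n) ℝ) : IsReachable (A - B * K) B := by
  intro p hp
  have key : ∀ k : ℕ, p ᵥ* (A - B * K) ^ k = p ᵥ* A ^ k := by
    intro k
    induction k with
    | zero => simp
    | succ k ih =>
      rw [pow_succ, ← Matrix.vecMul_vecMul, Matrix.vecMul_sub, ← Matrix.vecMul_vecMul (N := K),
        Matrix.vecMul_vecMul (N := B), hp, Matrix.zero_vecMul, sub_zero, ih, Matrix.vecMul_vecMul,
        ← pow_succ]
  refine h p fun k => ?_
  rw [← Matrix.vecMul_vecMul, ← key, Matrix.vecMul_vecMul, hp]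

/-- The matrix `B` of a controllable pair has independent columns. -/
theorem IsControllablePair.mulVec_injective {A : Matrix (Fin n) (Fin n) ℝ}
    {B : Matrix (Fin n) (Fin m) ℝ} (hAB : IsControllablePair A B) :
    Function.Injective (B *ᵥ ·) := by
  have := hAB.rank_eq
  rw [Matrix.mulVec_injective_iff]
  rw [linearIndependent_iff_card_eq_finrank_span]
  rw [Matrix.rank_eq_finrank_span_cols] at this
  simp [Set.finrank, this]

theorem eq_of_mul_eq_mul_of_injective {k : ℕ} {B : Matrix (Fin n) (Fin m) ℝ}
    (hB : Function.Injective (B *ᵥ ·)) {X Y : Matrix (Fin m) (Fin k) ℝ} (h : B * X = B * Y) :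
    X = Y := by
  apply Matrix.ext_of_mulVec_single
  intro i
  apply hB
  simp only [Matrix.mulVec_mulVec, h]

/-! ### Pencils of positive definite matrices -/

open scoped MatrixOrder in
/-- A pencil of symmetric matrices, one of them positive definite, has a real eigenvalue. -/
theorem exists_pencil_eigenvector [NeZero m] {R₁ R₂ : Matrix (Fin m) (Fin m) ℝ} (h₁ : R₁.PosDef)
    (h₂ : R₂.PosDef) : ∃ (c : ℝ) (x : Fin m → ℝ), x ≠ 0 ∧ R₂ *ᵥ x = c • (R₁ *ᵥ x) := by
  obtain ⟨Y, hY⟩ := CStarAlgebra.nonneg_iff_eq_star_mul_self.mp h₁.posSemidef.nonneg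
  have hYu : IsUnit Y := by
    have := h₁.isUnit
    rw [hY, Matrix.isUnit_iff_isUnit_det, Matrix.det_mul] at this
    rw [Matrix.isUnit_iff_isUnit_det]
    exact isUnit_of_mul_isUnit_right this
  have hYd := (Matrix.isUnit_iff_isUnit_det _).1 hYu
  have hher : ((Y⁻¹)ᴴ * R₂ * Y⁻¹).IsHermitian :=
    Matrix.isHermitian_conjTranspose_mul_mul _ h₂.isHermitian
  set w : Fin m → ℝ := (hher.eigenvectorBasis 0).ofLp
  have hw : ((Y⁻¹)ᴴ * R₂ * Y⁻¹) *ᵥ w = hher.eigenvalues 0 • w := hher.mulVec_eigenvectorBasis 0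
  have hw0 : w ≠ 0 := by
    intro h0
    apply hher.eigenvectorBasis.toBasis.ne_zero 0
    rw [OrthonormalBasis.coe_toBasis]
    ext i
    exact congrFun h0 i
  have hYY : Y *ᵥ (Y⁻¹ *ᵥ w) = w := by
    rw [Matrix.mulVec_mulVec, Matrix.mul_nonsing_inv _ hYd, Matrix.one_mulVec]
  refine ⟨hher.eigenvalues 0, Y⁻¹ *ᵥ w, fun h => hw0 ?_, ?_⟩
  · rw [← hYY, h, Matrix.mulVec_zero]
  · have hYi : Yᴴ * (Y⁻¹)ᴴ = 1 := by
      rw [← Matrix.conjTranspose_mul, Matrix.nonsing_inv_mul _ hYd, Matrix.conjTranspose_one]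
    calc R₂ *ᵥ (Y⁻¹ *ᵥ w) = Yᴴ *ᵥ (((Y⁻¹)ᴴ * R₂ * Y⁻¹) *ᵥ w) := by
          rw [Matrix.mulVec_mulVec, Matrix.mulVec_mulVec, ← Matrix.mul_assoc, ← Matrix.mul_assoc,
            hYi, Matrix.one_mul]
      _ = hher.eigenvalues 0 • (R₁ *ᵥ (Y⁻¹ *ᵥ w)) := by
          rw [hw, Matrix.mulVec_smul, hY, ← Matrix.mulVec_mulVec (M := star Y), hYY]
          rfl

/-- `R₂ S` is semisimple: it is self-adjoint for the inner product of matrix `S`. -/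
theorem pencil_semisimple {S R₂ : Matrix (Fin m) (Fin m) ℝ} (hS : S.PosDef)
    (h₂ : R₂.PosDef) (c : ℝ) {x : Fin m → ℝ}
    (hx : (R₂ * S - c • 1) *ᵥ ((R₂ * S - c • 1) *ᵥ x) = 0) :
    (R₂ * S - c • 1) *ᵥ x = 0 := by
  set M := R₂ * S - c • (1 : Matrix (Fin m) (Fin m) ℝ) with hM
  have hST : Sᵀ = S := hS.isHermitian
  have hRT : R₂ᵀ = R₂ := h₂.isHermitian
  have hMS : Mᵀ * S = S * M := by
    rw [hM, Matrix.transpose_sub, Matrix.transpose_mul, hST, hRT, Matrix.transpose_smul,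
      Matrix.transpose_one]
    simp [Matrix.sub_mul, Matrix.mul_sub, Matrix.mul_assoc]
  by_contra hne
  have hpos := hS.dotProduct_mulVec_pos hne
  have : star (M *ᵥ x) ⬝ᵥ S *ᵥ (M *ᵥ x) = 0 := by
    calc star (M *ᵥ x) ⬝ᵥ S *ᵥ (M *ᵥ x) = x ⬝ᵥ (Mᵀ * S) *ᵥ (M *ᵥ x) := by
          rw [← Matrix.mulVec_mulVec, Matrix.dotProduct_mulVec x Mᵀ, Matrix.vecMul_transpose,
            star_trivial]
      _ = 0 := by rw [hMS, ← Matrix.mulVec_mulVec, hx, Matrix.mulVec_zero, dotProduct_zero]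
  exact hpos.ne' this

/-! ### Rigidity of the weight `R` -/

/-- The difference of the two extremal solutions of the Riccati equation is invertible, because the
two closed-loop matrices coincide on its kernel, while their spectra are disjoint. -/
theorem isUnit_of_stable_antistable {F G D W : Matrix (Fin n) (Fin n) ℝ} (hF : IsAsympStable F)
    (hG : IsAsympAntistable G) (hGF : G = F - W * D) (hD : D * F + Fᵀ * D - D * W * D = 0) :
    IsUnit D := by
  have hDG : D * G = -(Fᵀ * D) := by
    rw [hGF, Matrix.mul_sub, ← Matrix.mul_assoc, eq_neg_iff_add_eq_zero, ← hD]
    abel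
  rw [← Matrix.mulVec_injective_iff_isUnit]
  refine (injective_iff_map_eq_zero' (Matrix.mulVecLin D)).2 ?_
  intro v
  refine ⟨fun hv => ?_, fun hv => by simp [hv]⟩
  rw [Matrix.mulVecLin_apply] at hv
  have hker : ∀ k : ℕ, D *ᵥ (G ^ k *ᵥ v) = 0 := by
    intro k
    induction k with
    | zero => simpa using hv
    | succ k ih =>
      rw [pow_succ', ← Matrix.mulVec_mulVec, Matrix.mulVec_mulVec, hDG, Matrix.neg_mulVec,
        ← Matrix.mulVec_mulVec, ih, Matrix.mulVec_zero, neg_zero]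
  refine eq_zero_of_pow_mulVec_eq (M := F) (M' := G)
    (fun z hz hz' => lt_asymm (hF z hz) (hG z hz')) fun k => ?_
  induction k with
  | zero => simp
  | succ k ih =>
    rw [pow_succ', ← Matrix.mulVec_mulVec, ih, pow_succ', ← Matrix.mulVec_mulVec, hGF,
      Matrix.sub_mulVec, ← Matrix.mulVec_mulVec (M := W), ← hGF, hker, Matrix.mulVec_zero, sub_zero]

theorem lyapunov_of_riccati {F X D W : Matrix (Fin n) (Fin n) ℝ} (hXD : X * D = 1)
    (h : D * F + Fᵀ * D - D * W * D = 0) : F * X + X * Fᵀ = W := by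
  have hDX : D * X = 1 := mul_eq_one_comm.1 hXD
  have h := congrArg (fun Z => X * Z * X) h
  simp only [Matrix.mul_sub, Matrix.mul_add, Matrix.sub_mul, Matrix.add_mul, Matrix.mul_zero,
    Matrix.zero_mul] at h
  have e1 : X * (D * F) * X = F * X := by rw [← Matrix.mul_assoc, hXD, Matrix.one_mul]
  have e2 : X * (Fᵀ * D) * X = X * Fᵀ := by
    rw [Matrix.mul_assoc, Matrix.mul_assoc, hDX, Matrix.mul_one]
  have e3 : X * (D * W * D) * X = W := by
    rw [Matrix.mul_assoc D, ← Matrix.mul_assoc X, hXD, Matrix.one_mul, Matrix.mul_assoc, hDX,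
      Matrix.mul_one]
  rw [e1, e2, e3] at h
  exact sub_eq_zero.1 h

theorem LeavesInvariant.of_ker {N M : Matrix (Fin n) (Fin n) ℝ} (h : N * M = M * N) :
    LeavesInvariant M (LinearMap.ker (Matrix.mulVecLin N)) := by
  intro v hv
  rw [LinearMap.mem_ker, Matrix.mulVecLin_apply] at hv ⊢
  rw [Matrix.mulVec_mulVec, h, ← Matrix.mulVec_mulVec, hv, Matrix.mulVec_zero]

theorem LeavesInvariant.of_range {N M : Matrix (Fin n) (Fin n) ℝ} (h : N * M = M * N) :
    LeavesInvariant M (LinearMap.range (Matrix.mulVecLin N)) := by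
  rintro v ⟨w, rfl⟩
  exact ⟨M *ᵥ w, by simp only [Matrix.mulVecLin_apply, Matrix.mulVec_mulVec, h]⟩

/-- Let `N` commute with the stable closed-loop matrix `F`, and act on the columns of `B` as
`R₁⁻¹ R₂`. Then `N` is semisimple and commutes with the anti-stable closed-loop matrix `G` too, so
that either `N` is a scalar, hence `R₂` is proportional to `R₁`, or the kernel and the range of
`N - c`, for an eigenvalue `c` of `N`, decompose the pair `(F, G)`. -/
theorem eq_smul_or_exists_isCompl {F G D N : Matrix (Fin n) (Fin n) ℝ}
    {B : Matrix (Fin n) (Fin m) ℝ} {R₁ R₂ : Matrix (Fin m) (Fin m) ℝ} (hF : IsAsympStable F)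
    (hG : IsAsympAntistable G) (hFB : IsReachable F B) (hB : Function.Injective (B *ᵥ ·))
    (h₁ : R₁.PosDef) (h₂ : R₂.PosDef) (hGF : G = F - B * R₁⁻¹ * Bᵀ * D)
    (hD : D * F + Fᵀ * D - D * (B * R₁⁻¹ * Bᵀ) * D = 0)
    (hNF : N * F = F * N) (hNB : N * B = B * (R₁⁻¹ * R₂)) :
    (∃ c : ℝ, R₂ = c • R₁) ∨ ∃ E₁ E₂ : Submodule ℝ (Fin n → ℝ),
      IsCompl E₁ E₂ ∧ E₁ ≠ ⊥ ∧ E₂ ≠ ⊥ ∧ LeavesInvariant F E₁ ∧ LeavesInvariant F E₂ ∧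
      LeavesInvariant G E₁ ∧ LeavesInvariant G E₂ := by
  rcases Nat.eq_zero_or_pos m with rfl | hm
  · exact Or.inl ⟨0, Subsingleton.elim _ _⟩
  have : NeZero m := ⟨hm.ne'⟩
  have hDu := isUnit_of_stable_antistable hF hG hGF hD
  have hDd := (Matrix.isUnit_iff_isUnit_det _).1 hDu
  have hR₁d := (Matrix.isUnit_iff_isUnit_det _).1 h₁.isUnit
  set S := R₁⁻¹ with hS
  have hSpd : S.PosDef := h₁.inv
  have hST : Sᵀ = S := hSpd.isHermitian
  have hRT : R₂ᵀ = R₂ := h₂.isHermitian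
  set W := B * S * Bᵀ with hW
  have hWT : Wᵀ = W := by
    simp [hW, Matrix.transpose_mul, hST, Matrix.mul_assoc]
  set X := D⁻¹ with hX
  have hXD : X * D = 1 := Matrix.nonsing_inv_mul _ hDd
  have hDX : D * X = 1 := Matrix.mul_nonsing_inv _ hDd
  have hlyap : F * X + X * Fᵀ = W := lyapunov_of_riccati hXD hD
  have hNW : N * W = W * Nᵀ := by
    have e : N * W = B * (S * R₂ * S) * Bᵀ := by
      rw [hW, ← Matrix.mul_assoc, ← Matrix.mul_assoc, hNB]
      simp only [Matrix.mul_assoc]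
    have e' := congrArg Matrix.transpose e
    simp only [Matrix.transpose_mul, hWT, hST, hRT, Matrix.transpose_transpose] at e'
    rw [e, e']
    simp only [Matrix.mul_assoc]
  have hNFT : Fᵀ * Nᵀ = Nᵀ * Fᵀ := by
    rw [← Matrix.transpose_mul, hNF, Matrix.transpose_mul]
  -- both `N X` and `X Nᵀ` solve the Lyapunov equation with right-hand side `N W = W Nᵀ`
  have hNX : N * X = X * Nᵀ := by
    rw [← sub_eq_zero]
    apply eq_zero_of_lyapunov hF hF.transpose
    have e1 : F * (N * X) + N * X * Fᵀ = N * W := by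
      rw [← hlyap, Matrix.mul_add, ← Matrix.mul_assoc, ← hNF, Matrix.mul_assoc, Matrix.mul_assoc]
    have e2 : F * (X * Nᵀ) + X * Nᵀ * Fᵀ = W * Nᵀ := by
      rw [← hlyap, Matrix.add_mul, Matrix.mul_assoc X Nᵀ, ← hNFT]
      simp only [Matrix.mul_assoc]
    rw [Matrix.mul_sub, Matrix.sub_mul, sub_add_sub_comm, e1, e2, hNW, sub_self]
  have hND : Nᵀ * D = D * N := by
    calc Nᵀ * D = D * (X * Nᵀ) * D := by
          rw [← Matrix.mul_assoc, hDX, Matrix.one_mul]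
      _ = D * N := by
          rw [← hNX, Matrix.mul_assoc, Matrix.mul_assoc N, hXD, Matrix.mul_one]
  have hNG : N * G = G * N := by
    rw [hGF, Matrix.mul_sub, Matrix.sub_mul, hNF, ← Matrix.mul_assoc, hNW, Matrix.mul_assoc W,
      hND, ← Matrix.mul_assoc]
  obtain ⟨c, x, hx0, hx⟩ := exists_pencil_eigenvector h₁ h₂
  set L := N - c • (1 : Matrix (Fin n) (Fin n) ℝ) with hL
  have hLF : L * F = F * L := by simp [hL, Matrix.sub_mul, Matrix.mul_sub, hNF]
  have hLG : L * G = G * L := by simp [hL, Matrix.sub_mul, Matrix.mul_sub, hNG]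
  have hLX : L * X = X * Lᵀ := by simp [hL, Matrix.sub_mul, Matrix.mul_sub, hNX]
  have hLB : L * B = B * (S * R₂ - c • 1) := by simp [hL, Matrix.sub_mul, Matrix.mul_sub, hNB]
  have hLFB : ∀ k : ℕ, L * (F ^ k * B) = F ^ k * B * (S * R₂ - c • 1) := by
    intro k
    rw [← Matrix.mul_assoc, ((show Commute L F from hLF).pow_right k).eq, Matrix.mul_assoc, hLB,
      Matrix.mul_assoc]
  by_cases hL0 : L = 0
  · left
    refine ⟨c, ?_⟩
    have h0 : B * (S * R₂ - c • 1) = 0 := by rw [← hLB, hL0, Matrix.zero_mul]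
    have h1 : S * R₂ - c • 1 = 0 :=
      eq_of_mul_eq_mul_of_injective hB (h0.trans (Matrix.mul_zero B).symm)
    have h2 := congrArg (R₁ * ·) (sub_eq_zero.1 h1)
    simpa [← Matrix.mul_assoc, hS, Matrix.mul_nonsing_inv _ hR₁d] using h2
  right
  -- on the generating vectors `F ^ k B u`, semisimplicity of `N` is that of `R₁⁻¹ R₂`; it comes out
  -- for the action on row vectors, and `N = X Nᵀ D` carries it over to column vectors
  have hrow : ∀ p : Fin n → ℝ, (p ᵥ* L) ᵥ* L = 0 → p ᵥ* L = 0 := by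
    intro p hp
    refine hFB _ fun k => ?_
    rw [Matrix.vecMul_vecMul, hLFB, ← Matrix.vecMul_vecMul]
    have hT : (S * R₂ - c • (1 : Matrix (Fin m) (Fin m) ℝ)) = (R₂ * S - c • 1)ᵀ := by
      simp [Matrix.transpose_sub, Matrix.transpose_mul, hST, hRT]
    rw [hT, Matrix.vecMul_transpose]
    apply pencil_semisimple hSpd h₂ c
    rw [← Matrix.vecMul_transpose, ← Matrix.vecMul_transpose, ← hT, Matrix.vecMul_vecMul p, ← hLFB,
      Matrix.vecMul_vecMul, Matrix.mul_assoc, ← hLFB, ← Matrix.vecMul_vecMul,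
      ← Matrix.vecMul_vecMul, hp, Matrix.zero_vecMul]
  have hcol : ∀ w : Fin n → ℝ, L *ᵥ (L *ᵥ w) = 0 → L *ᵥ w = 0 := by
    have hLXD : L = X * Lᵀ * D := by rw [← hLX, Matrix.mul_assoc, hXD, Matrix.mul_one]
    have hDL : D * L = Lᵀ * D := by
      conv_lhs => rw [hLXD]
      rw [← Matrix.mul_assoc, ← Matrix.mul_assoc, hDX, Matrix.one_mul]
    intro w hw
    have h := hrow (D *ᵥ w) (by
      rw [← Matrix.mulVec_transpose, ← Matrix.mulVec_transpose, Matrix.mulVec_mulVec (M := Lᵀ) (N := D),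
        ← hDL, ← Matrix.mulVec_mulVec, Matrix.mulVec_mulVec, ← hDL, ← Matrix.mulVec_mulVec, hw,
        Matrix.mulVec_zero])
    rw [← Matrix.mulVec_transpose, Matrix.mulVec_mulVec, ← hDL, ← Matrix.mulVec_mulVec] at h
    have h' := congrArg (X *ᵥ ·) h
    simpa [Matrix.mulVec_mulVec, ← Matrix.mul_assoc, hXD] using h'
  refine ⟨LinearMap.ker L.mulVecLin, LinearMap.range L.mulVecLin, ?_, ?_, ?_,
    .of_ker hLF, .of_range hLF, .of_ker hLG, .of_range hLG⟩
  · refine (Submodule.isCompl_iff_disjoint _ _ ?_).2 ?_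
    · rw [add_comm, LinearMap.finrank_range_add_finrank_ker]
    · rw [Submodule.disjoint_def]
      rintro _ h ⟨w, rfl⟩
      exact hcol w h
  · refine (Submodule.ne_bot_iff _).2 ⟨B *ᵥ x, ?_, fun h => hx0 (hB ?_)⟩
    · rw [LinearMap.mem_ker, Matrix.mulVecLin_apply, Matrix.mulVec_mulVec, hLB,
        ← Matrix.mulVec_mulVec, Matrix.sub_mulVec, ← Matrix.mulVec_mulVec, hx, Matrix.mulVec_smul,
        Matrix.mulVec_mulVec, hS, Matrix.nonsing_inv_mul _ hR₁d, Matrix.smul_mulVec,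
        Matrix.one_mulVec, sub_self, Matrix.mulVec_zero]
    · simpa using h
  · intro h
    rw [LinearMap.range_eq_bot] at h
    apply hL0
    exact Matrix.toLin'.injective (by simpa [Matrix.toLin'_apply'] using h)

end LQ

namespace LQ

variable {n m : ℕ}

open MeasureTheory Set

/-! ### Integration by parts along trajectories -/

/-- `f` is, on `[a, b]`, a primitive of the integrable function `f'`. -/
structure IsPrimitiveOn (a b : ℝ) (f f' : ℝ → ℝ) : Prop where
  intervalIntegrable : IntervalIntegrable f' volume a b
  eq_integral : ∀ t ∈ Icc a b, f t = f a + ∫ s in a..t, f' s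

theorem IsPrimitiveOn.of_hasDerivAt {a b : ℝ} {f f' : ℝ → ℝ} (h : ∀ t, HasDerivAt f (f' t) t)
    (hc : Continuous f') : IsPrimitiveOn a b f f' where
  intervalIntegrable := hc.intervalIntegrable _ _
  eq_integral t _ := by
    rw [intervalIntegral.integral_eq_sub_of_hasDerivAt (fun s _ => h s)
      (hc.intervalIntegrable _ _)]
    ring

/-- The product rule for primitives of integrable functions. -/
theorem IsPrimitiveOn.integral_mul {a b : ℝ} (hab : a ≤ b) {f f' g g' : ℝ → ℝ}
    (hf : IsPrimitiveOn a b f f') (hg : IsPrimitiveOn a b g g') :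
    IntervalIntegrable (fun t => f' t * g t + f t * g' t) volume a b ∧
      ∫ t in a..b, (f' t * g t + f t * g' t) = f b * g b - f a * g a := by
  have key : ∀ {f f' : ℝ → ℝ}, IsPrimitiveOn a b f f' →
      AbsolutelyContinuousOnInterval (fun t => f a + ∫ s in a..t, f' s) a b ∧
      ∀ᵐ t, t ∈ uIoc a b → HasDerivAt (fun t => f a + ∫ s in a..t, f' s) (f' t) t ∧
        f a + ∫ s in a..t, f' s = f t := by
    intro f f' hf
    constructor
    · exact AbsolutelyContinuousOnInterval.add
        (contDiff_const.contDiffOn.absolutelyContinuousOnInterval)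
        (hf.intervalIntegrable.absolutelyContinuousOnInterval_intervalIntegral left_mem_uIcc)
    · filter_upwards [hf.intervalIntegrable.ae_hasDerivAt_integral] with t ht htm
      refine ⟨(ht (uIoc_subset_uIcc htm) a left_mem_uIcc).const_add _, ?_⟩
      rw [← hf.eq_integral t]
      rw [← uIcc_of_le hab]
      exact uIoc_subset_uIcc htm
  obtain ⟨hf₁, hf₂⟩ := key hf
  obtain ⟨hg₁, hg₂⟩ := key hg
  have hcongr : ∀ᵐ t, t ∈ uIoc a b → deriv (fun t => f a + ∫ s in a..t, f' s) t *
      (g a + ∫ s in a..t, g' s) + (f a + ∫ s in a..t, f' s) *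
        deriv (fun t => g a + ∫ s in a..t, g' s) t = f' t * g t + f t * g' t := by
    filter_upwards [hf₂, hg₂] with t h1 h2 ht
    rw [(h1 ht).1.deriv, (h2 ht).1.deriv, (h1 ht).2, (h2 ht).2]
  constructor
  · refine ((hf₁.intervalIntegrable_deriv.mul_continuousOn hg₁.continuousOn).add
      (hg₁.intervalIntegrable_deriv.continuousOn_mul hf₁.continuousOn)).congr_ae ?_
    exact (ae_restrict_iff' measurableSet_uIoc).2 hcongr
  · rw [← intervalIntegral.integral_congr_ae hcongr, hf₁.integral_deriv_mul_eq_sub hg₁,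
      ← hf.eq_integral b (right_mem_Icc.2 hab), ← hg.eq_integral b (right_mem_Icc.2 hab)]
    simp

/-- The product rule for a bilinear form in two vectors of primitives. -/
theorem integral_bilin {a b : ℝ} (hab : a ≤ b) {x x' y y' : ℝ → Fin n → ℝ}
    (P : Matrix (Fin n) (Fin n) ℝ)
    (hx : ∀ i, IsPrimitiveOn a b (fun t => x t i) (fun t => x' t i))
    (hy : ∀ i, IsPrimitiveOn a b (fun t => y t i) (fun t => y' t i)) :
    IntervalIntegrable (fun t => x' t ⬝ᵥ P *ᵥ y t + x t ⬝ᵥ P *ᵥ y' t) volume a b ∧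
      ∫ t in a..b, (x' t ⬝ᵥ P *ᵥ y t + x t ⬝ᵥ P *ᵥ y' t) =
        x b ⬝ᵥ P *ᵥ y b - x a ⬝ᵥ P *ᵥ y a := by
  have hsum : ∀ u v : Fin n → ℝ, u ⬝ᵥ P *ᵥ v = ∑ i, ∑ j, P i j * (u i * v j) := by
    intro u v
    simp only [dotProduct, Matrix.mulVec, Finset.mul_sum]
    exact Finset.sum_congr rfl fun i _ => Finset.sum_congr rfl fun j _ => by ring
  have hfun : (fun t => x' t ⬝ᵥ P *ᵥ y t + x t ⬝ᵥ P *ᵥ y' t) =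
      fun t => ∑ i, ∑ j, P i j * (x' t i * y t j + x t i * y' t j) := by
    funext t
    rw [hsum, hsum, ← Finset.sum_add_distrib]
    refine Finset.sum_congr rfl fun i _ => ?_
    rw [← Finset.sum_add_distrib]
    exact Finset.sum_congr rfl fun j _ => by ring
  have hint : ∀ i j, IntervalIntegrable
      (fun t => P i j * (x' t i * y t j + x t i * y' t j)) volume a b := fun i j =>
    ((hx i).integral_mul hab (hy j)).1.const_mul _
  have hint' : ∀ i, IntervalIntegrable
      (fun t => ∑ j, P i j * (x' t i * y t j + x t i * y' t j)) volume a b := fun i =>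
    ⟨integrable_finsetSum _ fun j _ => (hint i j).1, integrable_finsetSum _ fun j _ => (hint i j).2⟩
  rw [hfun]
  constructor
  · exact ⟨integrable_finsetSum _ fun i _ => (hint' i).1,
      integrable_finsetSum _ fun i _ => (hint' i).2⟩
  · rw [intervalIntegral.integral_finsetSum fun i _ => hint' i]
    have : ∀ i, ∫ t in a..b, ∑ j, P i j * (x' t i * y t j + x t i * y' t j) =
        ∑ j, P i j * (x b i * y b j - x a i * y a j) := by
      intro i
      rw [intervalIntegral.integral_finsetSum fun j _ => hint i j]
      refine Finset.sum_congr rfl fun j _ => ?_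
      rw [intervalIntegral.integral_const_mul, ((hx i).integral_mul hab (hy j)).2]
    simp only [this, hsum, mul_sub, Finset.sum_sub_distrib]

section Trajectories

variable {A : Matrix (Fin n) (Fin n) ℝ} {B : Matrix (Fin n) (Fin m) ℝ} {t₀ t₁ : ℝ}
  {x : ℝ → Fin n → ℝ} {u : ℝ → Fin m → ℝ}

theorem IsTrajectory.integrableOn (h : IsTrajectory A B t₀ t₁ x u) :
    IntegrableOn (fun s => A *ᵥ x s + B *ᵥ u s) (Icc t₀ t₁) := by
  have h1 : IntegrableOn x (Icc t₀ t₁) := h.continuousOn.integrableOn_Icc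
  have h2 : IntegrableOn u (Icc t₀ t₁) := h.memLp.integrable (by norm_num)
  have h3 := (Matrix.mulVecLin A).toContinuousLinearMap.integrable_comp h1
  have h4 := (Matrix.mulVecLin B).toContinuousLinearMap.integrable_comp h2
  exact h3.add h4

theorem IsTrajectory.isPrimitiveOn (hab : t₀ ≤ t₁) (h : IsTrajectory A B t₀ t₁ x u) (i : Fin n) :
    IsPrimitiveOn t₀ t₁ (fun t => x t i) (fun t => (A *ᵥ x t + B *ᵥ u t) i) where
  intervalIntegrable := by
    rw [intervalIntegrable_iff_integrableOn_Icc_of_le hab]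
    exact (ContinuousLinearMap.proj (R := ℝ) (φ := fun _ : Fin n => ℝ) i).integrable_comp
      h.integrableOn
  eq_integral t ht := by
    have hint : IntervalIntegrable (fun s => A *ᵥ x s + B *ᵥ u s) volume t₀ t := by
      rw [intervalIntegrable_iff_integrableOn_Icc_of_le ht.1]
      exact h.integrableOn.mono_set (Icc_subset_Icc_right ht.2)
    have := (ContinuousLinearMap.proj (R := ℝ) (φ := fun _ : Fin n => ℝ) i).intervalIntegral_comp_comm
      hint
    simp only [ContinuousLinearMap.proj_apply] at this
    rw [this]
    exact congrFun (h.eq_integral t ht) i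

/-- The control deviation `u + K x` of a trajectory is square integrable. -/
theorem IsTrajectory.memLp_deviation (h : IsTrajectory A B t₀ t₁ x u)
    (K : Matrix (Fin m) (Fin n) ℝ) :
    MemLp (fun t => u t + K *ᵥ x t) 2 (volume.restrict (Icc t₀ t₁)) := by
  refine h.memLp.add ?_
  have hc : ContinuousOn (fun t => K *ᵥ x t) (Icc t₀ t₁) :=
    (Matrix.mulVecLin K).toContinuousLinearMap.continuous.comp_continuousOn h.continuousOn
  obtain ⟨C, hC⟩ := isCompact_Icc.exists_bound_of_continuousOn hc
  refine MemLp.of_bound (hc.aestronglyMeasurable measurableSet_Icc) C ?_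
  exact (ae_restrict_iff' measurableSet_Icc).2 (Filter.Eventually.of_forall hC)

theorem integrable_bilin_of_memLp {μ : Measure ℝ} {v w : ℝ → Fin m → ℝ} (hv : MemLp v 2 μ)
    (hw : MemLp w 2 μ) (R : Matrix (Fin m) (Fin m) ℝ) :
    Integrable (fun t => v t ⬝ᵥ R *ᵥ w t) μ := by
  have hsum : ∀ t, v t ⬝ᵥ R *ᵥ w t = ∑ i, ∑ j, R i j * (v t i * w t j) := by
    intro t
    simp only [dotProduct, Matrix.mulVec, Finset.mul_sum]
    exact Finset.sum_congr rfl fun i _ => Finset.sum_congr rfl fun j _ => by ring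
  simp only [hsum]
  have hp : ∀ {v : ℝ → Fin m → ℝ}, MemLp v 2 μ → ∀ i, MemLp (fun t => v t i) 2 μ := by
    intro v hv i
    exact (ContinuousLinearMap.proj (R := ℝ) (φ := fun _ : Fin m => ℝ) i).comp_memLp' hv
  exact integrable_finsetSum _ fun i _ => integrable_finsetSum _ fun j _ =>
    ((hp hv i).integrable_mul (hp hw j)).const_mul _

end Trajectories

/-! ### Linear flows -/

theorem hasDerivAt_flow {E : Type*} [NormedAddCommGroup E] [NormedSpace ℝ E] [CompleteSpace E]
    (H : E →L[ℝ] E) (z : E) (t : ℝ) :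
    HasDerivAt (fun s : ℝ => NormedSpace.exp (s • H) z) (H (NormedSpace.exp (t • H) z)) t :=
  (ContinuousLinearMap.apply ℝ E z).hasFDerivAt.comp_hasDerivAt t (hasDerivAt_exp_smul_const' H t)

/-- Two observed linear flows which agree on `[0, 1]` have the same Taylor coefficients at `0`. -/
theorem pow_apply_eq_of_flow_eq {E₁ E₂ G : Type*} [NormedAddCommGroup E₁] [NormedSpace ℝ E₁]
    [CompleteSpace E₁] [NormedAddCommGroup E₂] [NormedSpace ℝ E₂] [CompleteSpace E₂]
    [NormedAddCommGroup G] [NormedSpace ℝ G] (H₁ : E₁ →L[ℝ] E₁) (H₂ : E₂ →L[ℝ] E₂)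
    (C₁ : E₁ →L[ℝ] G) (C₂ : E₂ →L[ℝ] G) (z₁ : E₁) (z₂ : E₂)
    (h : ∀ t ∈ Icc (0 : ℝ) 1,
      C₁ (NormedSpace.exp (t • H₁) z₁) = C₂ (NormedSpace.exp (t • H₂) z₂)) (k : ℕ) :
    C₁ ((H₁ ^ k) z₁) = C₂ ((H₂ ^ k) z₂) := by
  have hd₁ : ∀ (k : ℕ) (t : ℝ), HasDerivAt (fun s : ℝ => C₁ ((H₁ ^ k) (NormedSpace.exp (s • H₁) z₁)))
      (C₁ ((H₁ ^ (k + 1)) (NormedSpace.exp (t • H₁) z₁))) t := fun k t => by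
    rw [pow_succ]
    exact (C₁.comp (H₁ ^ k)).hasFDerivAt.comp_hasDerivAt t (hasDerivAt_flow H₁ z₁ t)
  have hd₂ : ∀ (k : ℕ) (t : ℝ), HasDerivAt (fun s : ℝ => C₂ ((H₂ ^ k) (NormedSpace.exp (s • H₂) z₂)))
      (C₂ ((H₂ ^ (k + 1)) (NormedSpace.exp (t • H₂) z₂))) t := fun k t => by
    rw [pow_succ]
    exact (C₂.comp (H₂ ^ k)).hasFDerivAt.comp_hasDerivAt t (hasDerivAt_flow H₂ z₂ t)
  have hk : ∀ k : ℕ, EqOn (fun s : ℝ => C₁ ((H₁ ^ k) (NormedSpace.exp (s • H₁) z₁)))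
      (fun s : ℝ => C₂ ((H₂ ^ k) (NormedSpace.exp (s • H₂) z₂))) (Ioo 0 1) := by
    intro k
    induction k with
    | zero => intro t ht; simpa using h t (Ioo_subset_Icc_self ht)
    | succ k ih =>
      intro t ht
      refine (hd₁ k t).unique ((hd₂ k t).congr_of_eventuallyEq ?_)
      filter_upwards [Ioo_mem_nhds ht.1 ht.2] with s hs using ih hs
  have hcl := (hk k).closure
    (continuous_iff_continuousAt.2 fun t => (hd₁ k t).continuousAt)
    (continuous_iff_continuousAt.2 fun t => (hd₂ k t).continuousAt)
  have h0 : (0 : ℝ) ∈ closure (Ioo (0 : ℝ) 1) := by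
    rw [closure_Ioo (by norm_num)]
    simp
  simpa [NormedSpace.exp_zero] using hcl h0

/-! ### Extremals of a canonical cost -/

/-- The Hamiltonian vector field `(x, p) ↦ (F x + W p, -Fᵀ p)` of a canonical cost, where
`F = A - B K` and `W = B R⁻¹ Bᵀ`. -/
noncomputable def hamiltonianField (F W : Matrix (Fin n) (Fin n) ℝ) :
    ((Fin n → ℝ) × (Fin n → ℝ)) →L[ℝ] ((Fin n → ℝ) × (Fin n → ℝ)) :=
  LinearMap.toContinuousLinearMap
    (((Matrix.mulVecLin F).comp (LinearMap.fst ℝ _ _) +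
      (Matrix.mulVecLin W).comp (LinearMap.snd ℝ _ _)).prod
      (-(Matrix.mulVecLin Fᵀ).comp (LinearMap.snd ℝ _ _)))

@[simp]
theorem hamiltonianField_apply (F W : Matrix (Fin n) (Fin n) ℝ) (z : (Fin n → ℝ) × (Fin n → ℝ)) :
    hamiltonianField F W z = (F *ᵥ z.1 + W *ᵥ z.2, -(Fᵀ *ᵥ z.2)) := rfl

/-- The solutions of the Hamiltonian system of a canonical cost. -/
structure IsExtremal (F W : Matrix (Fin n) (Fin n) ℝ) (x p : ℝ → Fin n → ℝ) : Prop where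
  state : ∀ t, HasDerivAt x (F *ᵥ x t + W *ᵥ p t) t
  adjoint : ∀ t, HasDerivAt p (-(Fᵀ *ᵥ p t)) t

theorem isExtremal_flow (F W : Matrix (Fin n) (Fin n) ℝ) (z : (Fin n → ℝ) × (Fin n → ℝ)) :
    IsExtremal F W (fun t => (NormedSpace.exp (t • hamiltonianField F W) z).1)
      (fun t => (NormedSpace.exp (t • hamiltonianField F W) z).2) where
  state t := (hasDerivAt_flow (hamiltonianField F W) z t).fst
  adjoint t := (hasDerivAt_flow (hamiltonianField F W) z t).snd

section

variable {F W : Matrix (Fin n) (Fin n) ℝ} {x p : ℝ → Fin n → ℝ}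

theorem IsExtremal.continuous_state (h : IsExtremal F W x p) : Continuous x :=
  continuous_iff_continuousAt.2 fun t => (h.state t).continuousAt

theorem continuous_of_adjoint (h : ∀ t, HasDerivAt p (-(Fᵀ *ᵥ p t)) t) : Continuous p :=
  continuous_iff_continuousAt.2 fun t => (h t).continuousAt

theorem continuous_mulVec_comp {k l : ℕ} (M : Matrix (Fin k) (Fin l) ℝ) {y : ℝ → Fin l → ℝ}
    (hy : Continuous y) : Continuous fun t => M *ᵥ y t :=
  (Matrix.mulVecLin M).toContinuousLinearMap.continuous.comp hy

variable {A : Matrix (Fin n) (Fin n) ℝ} {B : Matrix (Fin n) (Fin m) ℝ}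
  {K : Matrix (Fin m) (Fin n) ℝ} {R : Matrix (Fin m) (Fin m) ℝ}

/-- The state of an extremal is the trajectory of the feedback control `u = R⁻¹ Bᵀ p - K x`. -/
theorem IsExtremal.isTrajectory (h : IsExtremal (A - B * K) (B * R⁻¹ * Bᵀ) x p) (t₀ t₁ : ℝ) :
    IsTrajectory A B t₀ t₁ x (fun t => (R⁻¹ * Bᵀ) *ᵥ p t - K *ᵥ x t) where
  continuousOn := h.continuous_state.continuousOn
  memLp := by
    have hc : Continuous (fun t => (R⁻¹ * Bᵀ) *ᵥ p t - K *ᵥ x t) :=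
      (continuous_mulVec_comp _ (continuous_of_adjoint h.adjoint)).sub
        (continuous_mulVec_comp _ h.continuous_state)
    obtain ⟨C, hC⟩ := isCompact_Icc.exists_bound_of_continuousOn (hc.continuousOn (s := Icc t₀ t₁))
    refine MemLp.of_bound hc.aestronglyMeasurable C ?_
    exact (ae_restrict_iff' measurableSet_Icc).2 (Filter.Eventually.of_forall hC)
  eq_integral t _ := by
    have hfun : (fun s => A *ᵥ x s + B *ᵥ ((R⁻¹ * Bᵀ) *ᵥ p s - K *ᵥ x s)) =
        fun s => (A - B * K) *ᵥ x s + (B * R⁻¹ * Bᵀ) *ᵥ p s := by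
      funext s
      rw [Matrix.mulVec_sub, Matrix.mulVec_mulVec, Matrix.mulVec_mulVec, Matrix.sub_mulVec,
        Matrix.mul_assoc]
      abel
    have hc : Continuous fun s => (A - B * K) *ᵥ x s + (B * R⁻¹ * Bᵀ) *ᵥ p s :=
      (continuous_mulVec_comp _ h.continuous_state).add
        (continuous_mulVec_comp _ (continuous_of_adjoint h.adjoint))
    rw [hfun, intervalIntegral.integral_eq_sub_of_hasDerivAt (fun s _ => h.state s)
      (hc.intervalIntegrable _ _)]
    abel

variable {t₀ t₁ : ℝ} {y : ℝ → Fin n → ℝ} {w : ℝ → Fin m → ℝ}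

/-- Along a trajectory `y`, the pairing `p ⬝ y` with a solution of the adjoint equation varies only
through the deviation `w + K y` of its control. -/
theorem integral_adjoint (hab : t₀ ≤ t₁) (hy : IsTrajectory A B t₀ t₁ y w)
    (hp : ∀ t, HasDerivAt p (-((A - B * K)ᵀ *ᵥ p t)) t) :
    IntervalIntegrable (fun t => p t ⬝ᵥ B *ᵥ (w t + K *ᵥ y t)) volume t₀ t₁ ∧
      ∫ t in t₀..t₁, p t ⬝ᵥ B *ᵥ (w t + K *ᵥ y t) = p t₁ ⬝ᵥ y t₁ - p t₀ ⬝ᵥ y t₀ := by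
  have hpp : ∀ i, IsPrimitiveOn t₀ t₁ (fun t => p t i) (fun t => (-((A - B * K)ᵀ *ᵥ p t)) i) := by
    intro i
    refine IsPrimitiveOn.of_hasDerivAt (fun t => (hasDerivAt_pi.1 (hp t)) i) ?_
    exact (continuous_apply i).comp (continuous_mulVec_comp _ (continuous_of_adjoint hp)).neg
  have key := integral_bilin hab 1 hpp (hy.isPrimitiveOn hab)
  have hfun : (fun t => -((A - B * K)ᵀ *ᵥ p t) ⬝ᵥ (1 : Matrix (Fin n) (Fin n) ℝ) *ᵥ y t +
      p t ⬝ᵥ (1 : Matrix (Fin n) (Fin n) ℝ) *ᵥ (A *ᵥ y t + B *ᵥ w t)) =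
      fun t => p t ⬝ᵥ B *ᵥ (w t + K *ᵥ y t) := by
    funext t
    rw [Matrix.one_mulVec, Matrix.one_mulVec, neg_dotProduct, Matrix.mulVec_transpose,
      ← Matrix.dotProduct_mulVec, Matrix.sub_mulVec, Matrix.mulVec_add, dotProduct_sub,
      dotProduct_add, dotProduct_add, Matrix.mulVec_mulVec]
    ring
  rw [hfun] at key
  simpa using key

theorem canonicalCost_intervalIntegrable (hab : t₀ ≤ t₁) (hy : IsTrajectory A B t₀ t₁ y w) :
    IntervalIntegrable (fun t => canonicalCost K R (y t) (w t)) volume t₀ t₁ := by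
  rw [intervalIntegrable_iff_integrableOn_Icc_of_le hab]
  exact integrable_bilin_of_memLp (hy.memLp_deviation K) (hy.memLp_deviation K) R

theorem IsExtremal.memLp (h : IsExtremal (A - B * K) W x p) :
    MemLp (fun t => (R⁻¹ * Bᵀ) *ᵥ p t) 2 (volume.restrict (Icc t₀ t₁)) := by
  have hc : Continuous (fun t => (R⁻¹ * Bᵀ) *ᵥ p t) :=
    continuous_mulVec_comp _ (continuous_of_adjoint h.adjoint)
  obtain ⟨C, hC⟩ := isCompact_Icc.exists_bound_of_continuousOn (hc.continuousOn (s := Icc t₀ t₁))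
  refine MemLp.of_bound hc.aestronglyMeasurable C ?_
  exact (ae_restrict_iff' measurableSet_Icc).2 (Filter.Eventually.of_forall hC)

/-- The excess of the cost of a trajectory over the cost of the extremal with the same end points
is the cost of the difference of the controls. -/
theorem IsExtremal.integral_cost (hab : t₀ ≤ t₁) (hR : R.PosDef)
    (h : IsExtremal (A - B * K) (B * R⁻¹ * Bᵀ) x p) (hy : IsTrajectory A B t₀ t₁ y w)
    (h₀ : y t₀ = x t₀) (h₁ : y t₁ = x t₁) :
    ∫ t in t₀..t₁, canonicalCost K R (y t) (w t) =
      (∫ t in t₀..t₁, canonicalCost K R (x t) ((R⁻¹ * Bᵀ) *ᵥ p t - K *ᵥ x t)) +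
      ∫ t in t₀..t₁, (w t + K *ᵥ y t - (R⁻¹ * Bᵀ) *ᵥ p t) ⬝ᵥ
        R *ᵥ (w t + K *ᵥ y t - (R⁻¹ * Bᵀ) *ᵥ p t) := by
  have hx := h.isTrajectory t₀ t₁
  obtain ⟨i₁, e₁⟩ := integral_adjoint (K := K) hab hy h.adjoint
  obtain ⟨i₂, e₂⟩ := integral_adjoint (K := K) hab hx h.adjoint
  have i₃ := canonicalCost_intervalIntegrable (K := K) (R := R) hab hx
  have i₄ : IntervalIntegrable (fun t => (w t + K *ᵥ y t - (R⁻¹ * Bᵀ) *ᵥ p t) ⬝ᵥ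
        R *ᵥ (w t + K *ᵥ y t - (R⁻¹ * Bᵀ) *ᵥ p t)) volume t₀ t₁ := by
    rw [intervalIntegrable_iff_integrableOn_Icc_of_le hab]
    exact integrable_bilin_of_memLp ((hy.memLp_deviation K).sub h.memLp)
      ((hy.memLp_deviation K).sub h.memLp) R
  have hRd := (Matrix.isUnit_iff_isUnit_det _).1 hR.isUnit
  have hRT : Rᵀ = R := hR.isHermitian
  have hpt : ∀ t, canonicalCost K R (y t) (w t) =
      canonicalCost K R (x t) ((R⁻¹ * Bᵀ) *ᵥ p t - K *ᵥ x t) +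
        (w t + K *ᵥ y t - (R⁻¹ * Bᵀ) *ᵥ p t) ⬝ᵥ
          R *ᵥ (w t + K *ᵥ y t - (R⁻¹ * Bᵀ) *ᵥ p t) +
        2 * (p t ⬝ᵥ B *ᵥ (w t + K *ᵥ y t) -
          p t ⬝ᵥ B *ᵥ ((R⁻¹ * Bᵀ) *ᵥ p t - K *ᵥ x t + K *ᵥ x t)) := by
    intro t
    set v := w t + K *ᵥ y t with hv
    set a := (R⁻¹ * Bᵀ) *ᵥ p t with ha
    have hRa : R *ᵥ a = Bᵀ *ᵥ p t := by
      rw [ha, Matrix.mulVec_mulVec, ← Matrix.mul_assoc, Matrix.mul_nonsing_inv _ hRd,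
        Matrix.one_mul]
    have hB : ∀ b, p t ⬝ᵥ B *ᵥ b = b ⬝ᵥ R *ᵥ a := by
      intro b
      rw [hRa, Matrix.dotProduct_mulVec, ← Matrix.mulVec_transpose, dotProduct_comm]
    have hsymm : a ⬝ᵥ R *ᵥ v = v ⬝ᵥ R *ᵥ a := by
      rw [Matrix.dotProduct_mulVec, ← Matrix.mulVec_transpose, hRT, dotProduct_comm]
    simp only [canonicalCost, sub_add_cancel, ← hv, hB, Matrix.mulVec_sub, dotProduct_sub,
      sub_dotProduct, hsymm]
    ring
  simp only [hpt]
  rw [intervalIntegral.integral_add (i₃.add i₄) ((i₁.sub i₂).const_mul 2),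
    intervalIntegral.integral_add i₃ i₄, intervalIntegral.integral_const_mul,
    intervalIntegral.integral_sub i₁ i₂, e₁, e₂, h₀, h₁]
  ring

/-- Extremals are minimizing. -/
theorem IsExtremal.isMinimizing (hab : t₀ ≤ t₁) (hR : R.PosDef)
    (h : IsExtremal (A - B * K) (B * R⁻¹ * Bᵀ) x p) :
    IsMinimizing A B (canonicalCost K R) t₀ t₁ x := by
  refine ⟨_, h.isTrajectory t₀ t₁, fun y w hy h₀ h₁ => ?_⟩
  rw [h.integral_cost hab hR hy h₀ h₁]
  refine le_add_of_nonneg_right (intervalIntegral.integral_nonneg hab fun t _ => ?_)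
  exact hR.posSemidef.dotProduct_mulVec_nonneg _

/-- A minimizing trajectory coincides with the extremal with the same end points, if any. -/
theorem IsExtremal.eqOn_of_isMinimizing (hab : t₀ ≤ t₁) (hR : R.PosDef)
    (h : IsExtremal (A - B * K) (B * R⁻¹ * Bᵀ) x p)
    (hy : IsMinimizing A B (canonicalCost K R) t₀ t₁ y)
    (h₀ : y t₀ = x t₀) (h₁ : y t₁ = x t₁) : EqOn y x (Icc t₀ t₁) := by
  obtain ⟨w, hyw, hmin⟩ := hy
  have hx := h.isTrajectory t₀ t₁
  have hle := hmin _ _ hx h₀.symm h₁.symm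
  rw [h.integral_cost hab hR hyw h₀ h₁] at hle
  have hnn : ∀ t, 0 ≤ (w t + K *ᵥ y t - (R⁻¹ * Bᵀ) *ᵥ p t) ⬝ᵥ
        R *ᵥ (w t + K *ᵥ y t - (R⁻¹ * Bᵀ) *ᵥ p t) := fun t =>
    hR.posSemidef.dotProduct_mulVec_nonneg _
  have hint : IntervalIntegrable (fun t => (w t + K *ᵥ y t - (R⁻¹ * Bᵀ) *ᵥ p t) ⬝ᵥ
        R *ᵥ (w t + K *ᵥ y t - (R⁻¹ * Bᵀ) *ᵥ p t)) volume t₀ t₁ := by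
    rw [intervalIntegrable_iff_integrableOn_Icc_of_le hab]
    exact integrable_bilin_of_memLp ((hyw.memLp_deviation K).sub h.memLp)
      ((hyw.memLp_deviation K).sub h.memLp) R
  have hzero := le_antisymm (by linarith)
    (intervalIntegral.integral_nonneg (μ := volume) hab fun t _ => hnn t)
  rw [intervalIntegral.integral_eq_zero_iff_of_le_of_nonneg_ae hab
    (Filter.Eventually.of_forall hnn) hint] at hzero
  have hdev : ∀ᵐ t, t ∈ Ioc t₀ t₁ → w t + K *ᵥ y t = (R⁻¹ * Bᵀ) *ᵥ p t := by
    rw [← ae_restrict_iff' measurableSet_Ioc]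
    filter_upwards [hzero] with t ht
    by_contra hne
    exact (hR.dotProduct_mulVec_pos (sub_ne_zero.2 hne)).ne' ht
  intro t ht
  -- test `y t - x t` against the solutions `q` of the adjoint equation, whose values at `t` are
  -- arbitrary
  have hq : ∀ v : Fin n → ℝ, v ⬝ᵥ (y t - x t) = 0 := by
    intro v
    obtain ⟨q, hq, hqt⟩ : ∃ q : ℝ → Fin n → ℝ,
        (∀ s, HasDerivAt q (-((A - B * K)ᵀ *ᵥ q s)) s) ∧ q t = v := by
      have hfl := (isExtremal_flow (A - B * K) 0
        (NormedSpace.exp (-t • hamiltonianField (A - B * K) 0) (0, v))).adjoint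
      refine ⟨_, hfl, ?_⟩
      have hmul : NormedSpace.exp (t • hamiltonianField (A - B * K) 0) *
          NormedSpace.exp (-t • hamiltonianField (A - B * K) 0) = 1 := by
        let _ : NormedAlgebra ℚ
            ((Fin n → ℝ) × (Fin n → ℝ) →L[ℝ] (Fin n → ℝ) × (Fin n → ℝ)) :=
          NormedAlgebra.restrictScalars ℚ ℝ _
        rw [← NormedSpace.exp_add_of_commute, ← add_smul, add_neg_cancel, zero_smul,
          NormedSpace.exp_zero]
        exact ((Commute.refl _).smul_left _).smul_right _
      have := congrArg (fun f => (f (0, v)).2) hmul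
      simpa using this
    have htr : ∀ {y : ℝ → Fin n → ℝ} {w : ℝ → Fin m → ℝ}, IsTrajectory A B t₀ t₁ y w →
        IsTrajectory A B t₀ t y w := fun hy =>
      ⟨hy.continuousOn.mono (Icc_subset_Icc_right ht.2),
        hy.memLp.mono_measure (Measure.restrict_mono (Icc_subset_Icc_right ht.2) le_rfl),
        fun s hs => hy.eq_integral s ⟨hs.1, hs.2.trans ht.2⟩⟩
    have e₁ := (integral_adjoint (K := K) ht.1 (htr hyw) hq).2
    have e₂ := (integral_adjoint (K := K) ht.1 (htr hx) hq).2
    have e₃ : ∫ s in t₀..t, q s ⬝ᵥ B *ᵥ (w s + K *ᵥ y s) =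
        ∫ s in t₀..t, q s ⬝ᵥ B *ᵥ ((R⁻¹ * Bᵀ) *ᵥ p s - K *ᵥ x s + K *ᵥ x s) := by
      apply intervalIntegral.integral_congr_ae
      filter_upwards [hdev] with s hs hst
      rw [uIoc_of_le ht.1] at hst
      rw [hs ⟨hst.1, hst.2.trans ht.2⟩, sub_add_cancel]
    rw [dotProduct_sub, ← hqt]
    rw [e₁, e₂, h₀] at e₃
    linarith
  have := dotProduct_eq_zero (y t - x t) fun v => by rw [dotProduct_comm]; exact hq v
  exact sub_eq_zero.1 this

end

theorem pow_hamiltonianField_snd (F W : Matrix (Fin n) (Fin n) ℝ)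
    (z : (Fin n → ℝ) × (Fin n → ℝ)) (k : ℕ) :
    ((hamiltonianField F W ^ k) z).2 = (-1 : ℝ) ^ k • (z.2 ᵥ* F ^ k) := by
  induction k with
  | zero => simp
  | succ k ih =>
    rw [pow_succ', mul_apply_eq_comp, hamiltonianField_apply, ih,
      Matrix.mulVec_transpose, Matrix.smul_vecMul, Matrix.vecMul_vecMul, ← pow_succ,
      pow_succ' (-1 : ℝ), mul_smul, neg_one_smul]

theorem snd_eq_zero_of_isReachable {F W : Matrix (Fin n) (Fin n) ℝ} {B : Matrix (Fin n) (Fin m) ℝ}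
    (hFB : IsReachable F B) {z : (Fin n → ℝ) × (Fin n → ℝ)}
    (h : ∀ k : ℕ, Bᵀ *ᵥ ((hamiltonianField F W ^ k) z).2 = 0) : z.2 = 0 := by
  refine hFB _ fun k => ?_
  have hk := h k
  rw [pow_hamiltonianField_snd, Matrix.mulVec_smul, Matrix.mulVec_transpose,
    Matrix.vecMul_vecMul] at hk
  exact (smul_eq_zero.1 hk).resolve_left (pow_ne_zero _ (by norm_num))

section

variable {B : Matrix (Fin n) (Fin m) ℝ} {R : Matrix (Fin m) (Fin m) ℝ}

theorem transpose_mulVec_eq_zero_of_dotProduct (hR : R.PosDef) {p : Fin n → ℝ}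
    (h : p ⬝ᵥ (B * R⁻¹ * Bᵀ) *ᵥ p = 0) : Bᵀ *ᵥ p = 0 := by
  by_contra hne
  refine (hR.inv.dotProduct_mulVec_pos hne).ne' ?_
  rw [star_trivial, ← h, ← Matrix.mulVec_mulVec, ← Matrix.mulVec_mulVec,
    Matrix.dotProduct_mulVec p, Matrix.mulVec_transpose]

theorem dotProduct_gram_nonneg (hR : R.PosDef) (p : Fin n → ℝ) :
    0 ≤ p ⬝ᵥ (B * R⁻¹ * Bᵀ) *ᵥ p := by
  have := hR.inv.posSemidef.dotProduct_mulVec_nonneg (Bᵀ *ᵥ p)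
  rwa [star_trivial, Matrix.mulVec_transpose, ← Matrix.dotProduct_mulVec,
    ← Matrix.mulVec_transpose, Matrix.mulVec_mulVec, Matrix.mulVec_mulVec] at this

/-- The state component observes the Hamiltonian system of a canonical cost. -/
theorem eq_zero_of_pow_hamiltonianField_fst {F : Matrix (Fin n) (Fin n) ℝ}
    (hFB : IsReachable F B) (hR : R.PosDef) {z : (Fin n → ℝ) × (Fin n → ℝ)}
    (h : ∀ k : ℕ, ((hamiltonianField F (B * R⁻¹ * Bᵀ) ^ k) z).1 = 0) : z = 0 := by
  refine Prod.ext (by simpa using h 0) (snd_eq_zero_of_isReachable hFB (W := B * R⁻¹ * Bᵀ)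
    fun k => ?_)
  have hk := h (k + 1)
  rw [pow_succ', mul_apply_eq_comp, hamiltonianField_apply] at hk
  simp only [h k, Matrix.mulVec_zero, zero_add] at hk
  apply transpose_mulVec_eq_zero_of_dotProduct hR
  rw [hk, dotProduct_zero]

variable {A : Matrix (Fin n) (Fin n) ℝ} {K : Matrix (Fin m) (Fin n) ℝ}

/-- Any two points are joined on `[0, 1]` by an extremal: the linear map sending the initial
costate to the final state is injective, since an extremal from `0` to `0` has zero cost. -/
theorem exists_extremal (hFB : IsReachable (A - B * K) B) (hR : R.PosDef) (a b : Fin n → ℝ) :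
    ∃ z : (Fin n → ℝ) × (Fin n → ℝ), z.1 = a ∧
      (NormedSpace.exp ((1 : ℝ) • hamiltonianField (A - B * K) (B * R⁻¹ * Bᵀ)) z).1 = b := by
  set H := hamiltonianField (A - B * K) (B * R⁻¹ * Bᵀ) with hH
  set ψ : (Fin n → ℝ) →ₗ[ℝ] (Fin n → ℝ) := (LinearMap.fst ℝ _ _).comp
    ((NormedSpace.exp ((1 : ℝ) • H)).toLinearMap.comp (LinearMap.inr ℝ (Fin n → ℝ) (Fin n → ℝ)))
    with hψ
  have hinj : Function.Injective ψ := by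
    rw [injective_iff_map_eq_zero]
    intro p₀ hp₀
    set x : ℝ → Fin n → ℝ := fun t => (NormedSpace.exp (t • H) (0, p₀)).1 with hx
    set p : ℝ → Fin n → ℝ := fun t => (NormedSpace.exp (t • H) (0, p₀)).2 with hp
    have hext : IsExtremal (A - B * K) (B * R⁻¹ * Bᵀ) x p := isExtremal_flow _ _ _
    have e := (integral_adjoint (K := K) zero_le_one (hext.isTrajectory 0 1) hext.adjoint).2
    have hx0 : x 0 = 0 := by simp [hx, NormedSpace.exp_zero]
    have hx1 : x 1 = 0 := hp₀
    simp only [sub_add_cancel, Matrix.mulVec_mulVec, ← Matrix.mul_assoc, hx0, hx1,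
      dotProduct_zero, sub_self] at e
    have hcp := continuous_of_adjoint hext.adjoint
    have hz : ∀ t ∈ Icc (0 : ℝ) 1, p t ⬝ᵥ (B * R⁻¹ * Bᵀ) *ᵥ p t = 0 := by
      intro t ht
      by_contra hne
      refine (intervalIntegral.integral_pos (f := fun t => p t ⬝ᵥ (B * R⁻¹ * Bᵀ) *ᵥ p t)
        zero_lt_one ?_ (fun s _ => dotProduct_gram_nonneg hR _)
        ⟨t, ht, lt_of_le_of_ne (dotProduct_gram_nonneg hR _) (Ne.symm hne)⟩).ne' e
      exact (hcp.dotProduct (continuous_mulVec_comp _ hcp)).continuousOn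
    have hk := pow_apply_eq_of_flow_eq H (0 : ℝ →L[ℝ] ℝ)
      ((Matrix.mulVecLin Bᵀ).toContinuousLinearMap.comp
        (ContinuousLinearMap.snd ℝ (Fin n → ℝ) (Fin n → ℝ))) 0 (0, p₀) 0
      (fun t ht => transpose_mulVec_eq_zero_of_dotProduct hR (hz t ht))
    exact snd_eq_zero_of_isReachable (z := (0, p₀)) hFB hk
  obtain ⟨p₀, hp₀⟩ := LinearMap.injective_iff_surjective.1 hinj
    (b - (NormedSpace.exp ((1 : ℝ) • H) (a, 0)).1)
  refine ⟨(a, p₀), rfl, ?_⟩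
  have hsplit : (a, p₀) = (a, (0 : Fin n → ℝ)) + ((0 : Fin n → ℝ), p₀) := by simp
  rw [hsplit, map_add, Prod.fst_add]
  have : (NormedSpace.exp ((1 : ℝ) • H) (0, p₀)).1 = ψ p₀ := rfl
  rw [this, hp₀]
  abel

end

/-! ### Canonical costs with the same synthesis -/

/-- Two canonical costs with the same optimal synthesis have the same feedback, and their weights
are related by an endomorphism which commutes with the common closed-loop matrix. The equality of
the extremals on `[0, 1]` gives a linear isomorphism `T` which intertwines the two Hamiltonian
systems and preserves the state; its lower left block solves a homogeneous Lyapunov equation,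
hence vanishes. -/
theorem eq_and_exists_intertwiner {A : Matrix (Fin n) (Fin n) ℝ} {B : Matrix (Fin n) (Fin m) ℝ}
    (hAB : IsControllablePair A B) {K₁ K₂ : Matrix (Fin m) (Fin n) ℝ}
    {R₁ R₂ : Matrix (Fin m) (Fin m) ℝ} (hR₁ : R₁.PosDef) (hR₂ : R₂.PosDef)
    (hK₁ : IsAsympStable (A - B * K₁)) (hK₂ : IsAsympStable (A - B * K₂))
    (h : optimalSynthesis A B (canonicalCost K₁ R₁) = optimalSynthesis A B (canonicalCost K₂ R₂)) :
    K₁ = K₂ ∧ ∃ N : Matrix (Fin n) (Fin n) ℝ,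
      N * (A - B * K₁) = (A - B * K₁) * N ∧ N * B = B * (R₁⁻¹ * R₂) := by
  have hB := hAB.mulVec_injective
  have hreach₂ := hAB.isReachable.feedback K₂
  set F₁ := A - B * K₁ with hF₁
  set F₂ := A - B * K₂ with hF₂
  set W₁ := B * R₁⁻¹ * Bᵀ with hW₁
  set W₂ := B * R₂⁻¹ * Bᵀ with hW₂
  set H₁ := hamiltonianField F₁ W₁ with hH₁
  set H₂ := hamiltonianField F₂ W₂ with hH₂
  have hex : ∀ z₁ : (Fin n → ℝ) × (Fin n → ℝ), ∃ z₂ : (Fin n → ℝ) × (Fin n → ℝ),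
      ∀ k : ℕ, ((H₁ ^ k) z₁).1 = ((H₂ ^ k) z₂).1 := by
    intro z₁
    have hext := isExtremal_flow F₁ W₁ z₁
    have hmem : ((0 : ℝ), (1 : ℝ), fun t : ℝ => (NormedSpace.exp (t • H₁) z₁).1) ∈
        optimalSynthesis A B (canonicalCost K₂ R₂) := by
      rw [← h]
      exact ⟨zero_lt_one, hext.isMinimizing zero_le_one hR₁⟩
    obtain ⟨z₂, h0, h1⟩ := exists_extremal hreach₂ hR₂ z₁.1 (NormedSpace.exp ((1 : ℝ) • H₁) z₁).1
    have heq := (isExtremal_flow F₂ W₂ z₂).eqOn_of_isMinimizing zero_le_one hR₂ hmem.2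
      (by simp [NormedSpace.exp_zero, h0]) h1.symm
    exact ⟨z₂, pow_apply_eq_of_flow_eq H₁ H₂ (ContinuousLinearMap.fst ℝ _ _)
      (ContinuousLinearMap.fst ℝ _ _) z₁ z₂ heq⟩
  choose g hg using hex
  -- the initial point of the second extremal is unique by observability, hence depends linearly
  -- on that of the first
  have hobs : ∀ z z' : (Fin n → ℝ) × (Fin n → ℝ),
      (∀ k : ℕ, ((H₂ ^ k) z).1 = ((H₂ ^ k) z').1) → z = z' := by
    intro z z' hzz
    rw [← sub_eq_zero]
    refine eq_zero_of_pow_hamiltonianField_fst hreach₂ hR₂ fun k => ?_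
    rw [map_sub, Prod.fst_sub, hzz k, sub_self]
  let T : ((Fin n → ℝ) × (Fin n → ℝ)) →ₗ[ℝ] ((Fin n → ℝ) × (Fin n → ℝ)) :=
    { toFun := g
      map_add' := fun z z' => hobs _ _ fun k => by
        rw [← hg, map_add, map_add, Prod.fst_add, Prod.fst_add, hg, hg]
      map_smul' := fun c z => hobs _ _ fun k => by
        rw [← hg, map_smul, RingHom.id_apply, map_smul, Prod.smul_fst, Prod.smul_fst, hg] }
  have hT1 : ∀ z, (T z).1 = z.1 := fun z => (hg z 0).symm
  have hTH : ∀ z, T (H₁ z) = H₂ (T z) := fun z => hobs _ _ fun k => by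
    have e := hg z (k + 1)
    rw [pow_succ, pow_succ] at e
    exact (hg (H₁ z) k).symm.trans e
  set T₂₁ : Matrix (Fin n) (Fin n) ℝ := LinearMap.toMatrix'
    ((LinearMap.snd ℝ _ _).comp (T.comp (LinearMap.inl ℝ _ _))) with hT₂₁
  set T₂₂ : Matrix (Fin n) (Fin n) ℝ := LinearMap.toMatrix'
    ((LinearMap.snd ℝ _ _).comp (T.comp (LinearMap.inr ℝ _ _))) with hT₂₂
  have hTl : ∀ x, T (x, 0) = (x, T₂₁ *ᵥ x) := fun x => Prod.ext (hT1 _) (by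
    rw [hT₂₁, LinearMap.toMatrix'_mulVec]; rfl)
  have hTr : ∀ p, T (0, p) = (0, T₂₂ *ᵥ p) := fun x => Prod.ext (hT1 _) (by
    rw [hT₂₂, LinearMap.toMatrix'_mulVec]; rfl)
  have hTa : ∀ x p, T (x, p) = (x, T₂₁ *ᵥ x + T₂₂ *ᵥ p) := fun x p => by
    have : (x, p) = (x, (0 : Fin n → ℝ)) + ((0 : Fin n → ℝ), p) := by simp
    rw [this, map_add, hTl, hTr]
    simp
  have e1 : ∀ x, (F₁ *ᵥ x, T₂₁ *ᵥ (F₁ *ᵥ x)) =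
      (F₂ *ᵥ x + W₂ *ᵥ (T₂₁ *ᵥ x), -(F₂ᵀ *ᵥ (T₂₁ *ᵥ x))) := fun x => by
    have := hTH (x, 0)
    rw [hH₁, hH₂, hamiltonianField_apply, hamiltonianField_apply, hTa, hTa] at this
    simpa using this
  have e2 : ∀ p, (W₁ *ᵥ p, T₂₁ *ᵥ (W₁ *ᵥ p) + T₂₂ *ᵥ (-(F₁ᵀ *ᵥ p))) =
      (W₂ *ᵥ (T₂₂ *ᵥ p), -(F₂ᵀ *ᵥ (T₂₂ *ᵥ p))) := fun p => by
    have := hTH (0, p)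
    rw [hH₁, hH₂, hamiltonianField_apply, hamiltonianField_apply, hTa, hTa] at this
    simpa using this
  have hext : ∀ {M M' : Matrix (Fin n) (Fin n) ℝ}, (∀ v, M *ᵥ v = M' *ᵥ v) → M = M' :=
    fun hv => Matrix.ext_of_mulVec_single fun i => hv _
  have hz : T₂₁ = 0 := by
    refine eq_zero_of_lyapunov hK₂.transpose hK₁ (hext fun v => ?_)
    have := congrArg Prod.snd (e1 v)
    simp only at this
    rw [Matrix.add_mulVec, ← Matrix.mulVec_mulVec, ← Matrix.mulVec_mulVec, this, Matrix.zero_mulVec,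
      add_neg_cancel]
  have hF : F₁ = F₂ := hext fun v => by
    have := congrArg Prod.fst (e1 v)
    simpa [hz] using this
  have hW : W₁ = W₂ * T₂₂ := hext fun v => by
    have := congrArg Prod.fst (e2 v)
    simp only at this
    rw [this, Matrix.mulVec_mulVec]
  have hc : T₂₂ * F₁ᵀ = F₁ᵀ * T₂₂ := hext fun v => by
    have := congrArg Prod.snd (e2 v)
    simp only [hz, Matrix.zero_mulVec, zero_add, Matrix.mulVec_neg, neg_inj, ← hF] at this
    rwa [← Matrix.mulVec_mulVec, ← Matrix.mulVec_mulVec]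
  have hR₁T : R₁ᵀ = R₁ := hR₁.isHermitian
  have hR₂T : R₂ᵀ = R₂ := hR₂.isHermitian
  have hR₂d := (Matrix.isUnit_iff_isUnit_det _).1 hR₂.isUnit
  refine ⟨eq_of_mul_eq_mul_of_injective hB (sub_right_injective hF), T₂₂ᵀ, ?_, ?_⟩
  · have := congrArg Matrix.transpose hc
    rw [Matrix.transpose_mul, Matrix.transpose_mul, Matrix.transpose_transpose] at this
    exact this.symm
  · have e3 : R₁⁻¹ * Bᵀ = R₂⁻¹ * Bᵀ * T₂₂ := by
      apply eq_of_mul_eq_mul_of_injective hB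
      rw [← Matrix.mul_assoc, ← Matrix.mul_assoc, ← Matrix.mul_assoc]
      exact hW
    have e4 := congrArg Matrix.transpose e3
    rw [Matrix.transpose_mul, Matrix.transpose_mul, Matrix.transpose_mul,
      Matrix.transpose_transpose, Matrix.transpose_nonsing_inv, Matrix.transpose_nonsing_inv, hR₁T,
      hR₂T, ← Matrix.mul_assoc] at e4
    rw [← Matrix.mul_assoc, e4, Matrix.mul_assoc, Matrix.nonsing_inv_mul _ hR₂d, Matrix.mul_one]

/-! ### Reduction to a canonical cost -/

section

variable {A : Matrix (Fin n) (Fin n) ℝ} {B : Matrix (Fin n) (Fin m) ℝ}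
  {Q : Matrix (Fin n) (Fin n) ℝ} {S : Matrix (Fin n) (Fin m) ℝ} {R : Matrix (Fin m) (Fin m) ℝ}
  {P : Matrix (Fin n) (Fin n) ℝ}

/-- Completion of the square with a solution of the Riccati equation. -/
theorem quadraticCost_eq (hR : R.PosDef) (hP : IsRiccatiSolution A B Q S R P) (x : Fin n → ℝ)
    (u : Fin m → ℝ) :
    quadraticCost Q S R x u = canonicalCost (R⁻¹ * (Sᵀ + Bᵀ * P)) R x u -
      ((A *ᵥ x + B *ᵥ u) ⬝ᵥ P *ᵥ x + x ⬝ᵥ P *ᵥ (A *ᵥ x + B *ᵥ u)) := by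
  have hRd := (Matrix.isUnit_iff_isUnit_det _).1 hR.isUnit
  have hRT : Rᵀ = R := hR.isHermitian
  have hPT : Pᵀ = P := hP.1
  set K := R⁻¹ * (Sᵀ + Bᵀ * P) with hK
  have hRK : R * K = Sᵀ + Bᵀ * P := by
    rw [hK, ← Matrix.mul_assoc, Matrix.mul_nonsing_inv _ hRd, Matrix.one_mul]
  have hKT : Kᵀ * R = S + P * B := by
    have := congrArg Matrix.transpose hRK
    simpa [Matrix.transpose_mul, hRT, hPT] using this
  have hKRK : Kᵀ * R * K = P * A + Aᵀ * P + Q := by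
    have h := hP.2
    rw [hKT, hK, ← Matrix.mul_assoc, eq_comm, ← sub_eq_zero, ← h]
    abel
  have swap : ∀ {k l : ℕ} (M : Matrix (Fin k) (Fin l) ℝ) (a : Fin k → ℝ) (b : Fin l → ℝ),
      a ⬝ᵥ M *ᵥ b = b ⬝ᵥ Mᵀ *ᵥ a := fun M a b => by
    rw [Matrix.dotProduct_mulVec, ← Matrix.mulVec_transpose, dotProduct_comm]
  have e0 : u ⬝ᵥ R *ᵥ (K *ᵥ x) = u ⬝ᵥ Sᵀ *ᵥ x + u ⬝ᵥ Bᵀ *ᵥ (P *ᵥ x) := by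
    rw [Matrix.mulVec_mulVec, hRK, Matrix.add_mulVec, dotProduct_add, ← Matrix.mulVec_mulVec]
  have e1 : K *ᵥ x ⬝ᵥ R *ᵥ u = u ⬝ᵥ R *ᵥ (K *ᵥ x) := by rw [swap, hRT]
  have e2 : K *ᵥ x ⬝ᵥ R *ᵥ (K *ᵥ x) =
      x ⬝ᵥ P *ᵥ (A *ᵥ x) + x ⬝ᵥ Aᵀ *ᵥ (P *ᵥ x) + x ⬝ᵥ Q *ᵥ x := by
    rw [dotProduct_comm, swap K, Matrix.mulVec_mulVec, Matrix.mulVec_mulVec, hKRK]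
    simp only [Matrix.add_mulVec, dotProduct_add, Matrix.mulVec_mulVec]
  have e3 : (A *ᵥ x) ⬝ᵥ P *ᵥ x = x ⬝ᵥ Aᵀ *ᵥ (P *ᵥ x) := by rw [dotProduct_comm, swap]
  have e4 : (B *ᵥ u) ⬝ᵥ P *ᵥ x = u ⬝ᵥ Bᵀ *ᵥ (P *ᵥ x) := by rw [dotProduct_comm, swap]
  have e5 : x ⬝ᵥ P *ᵥ (B *ᵥ u) = u ⬝ᵥ Bᵀ *ᵥ (P *ᵥ x) := by rw [swap, hPT, e4]
  simp only [quadraticCost, canonicalCost, Matrix.mulVec_add, dotProduct_add, add_dotProduct, e0,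
    e1, e2, e3, e4, e5, swap S]
  ring

/-- If, up to a positive factor, two costs of a trajectory differ by a function of its end points,
they have the same optimal synthesis. -/
theorem optimalSynthesis_eq {c c' : (Fin n → ℝ) → (Fin m → ℝ) → ℝ} {r : ℝ} (hr : 0 < r)
    (φ : (Fin n → ℝ) → (Fin n → ℝ) → ℝ)
    (h : ∀ (t₀ t₁ : ℝ) (x : ℝ → Fin n → ℝ) (u : ℝ → Fin m → ℝ), t₀ < t₁ →
      IsTrajectory A B t₀ t₁ x u →
      ∫ t in t₀..t₁, c (x t) (u t) = r * (∫ t in t₀..t₁, c' (x t) (u t)) + φ (x t₀) (x t₁)) :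
    optimalSynthesis A B c = optimalSynthesis A B c' := by
  ext ⟨t₀, t₁, x⟩
  simp only [optimalSynthesis, IsMinimizing, mem_ofPred_eq]
  refine and_congr_right fun hlt => exists_congr fun u => and_congr_right fun hu => ?_
  refine forall_congr' fun y => forall_congr' fun v => forall_congr' fun hv => ?_
  refine forall_congr' fun h₀ => forall_congr' fun h₁ => ?_
  rw [h _ _ _ _ hlt hu, h _ _ _ _ hlt hv, h₀, h₁, add_le_add_iff_right, mul_le_mul_iff_right₀ hr]

/-- A quadratic cost has the same optimal synthesis as the canonical costs which a solution of the
Riccati equation provides. -/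
theorem optimalSynthesis_quadraticCost (hR : R.PosDef) (hP : IsRiccatiSolution A B Q S R P) {r : ℝ}
    (hr : 0 < r) :
    optimalSynthesis A B (canonicalCost (R⁻¹ * (Sᵀ + Bᵀ * P)) (r • R)) =
      optimalSynthesis A B (quadraticCost Q S R) := by
  refine optimalSynthesis_eq hr (fun a b => r * (b ⬝ᵥ P *ᵥ b - a ⬝ᵥ P *ᵥ a)) ?_
  intro t₀ t₁ x u hlt hx
  obtain ⟨i₁, e₁⟩ := integral_bilin hlt.le P (hx.isPrimitiveOn hlt.le) (hx.isPrimitiveOn hlt.le)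
  have i₂ := canonicalCost_intervalIntegrable (K := R⁻¹ * (Sᵀ + Bᵀ * P)) (R := R) hlt.le hx
  have hsm : ∀ t, canonicalCost (R⁻¹ * (Sᵀ + Bᵀ * P)) (r • R) (x t) (u t) =
      r * canonicalCost (R⁻¹ * (Sᵀ + Bᵀ * P)) R (x t) (u t) := fun t => by
    simp only [canonicalCost, Matrix.smul_mulVec, dotProduct_smul, smul_eq_mul]
  simp only [quadraticCost_eq hR hP, hsm]
  rw [intervalIntegral.integral_const_mul, intervalIntegral.integral_sub i₂ i₁, e₁]
  ring

theorem closedLoop_eq : closedLoop A B S R P = A - B * (R⁻¹ * (Sᵀ + Bᵀ * P)) := by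
  rw [closedLoop, Matrix.mul_assoc]

/-- The equation for the difference of two solutions of the Riccati equation. -/
theorem IsRiccatiSolution.sub {P' : Matrix (Fin n) (Fin n) ℝ} (hR : R.PosDef)
    (hP : IsRiccatiSolution A B Q S R P) (hP' : IsRiccatiSolution A B Q S R P') :
    (P' - P) * closedLoop A B S R P + (closedLoop A B S R P)ᵀ * (P' - P) -
      (P' - P) * (B * R⁻¹ * Bᵀ) * (P' - P) = 0 := by
  have hPT : Pᵀ = P := hP.1
  have hRT : (R⁻¹)ᵀ = R⁻¹ := hR.inv.isHermitian
  have h := hP'.2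
  obtain ⟨D, rfl⟩ : ∃ D, P' = P + D := ⟨P' - P, by abel⟩
  rw [← hP.2] at h
  rw [add_sub_cancel_left, ← sub_eq_zero.2 h]
  simp only [closedLoop, Matrix.transpose_sub, Matrix.transpose_mul, Matrix.transpose_add,
    Matrix.transpose_transpose, hPT, hRT, Matrix.mul_add, Matrix.add_mul, Matrix.mul_sub,
    Matrix.sub_mul, Matrix.mul_assoc]
  abel

theorem closedLoop_sub (P' : Matrix (Fin n) (Fin n) ℝ) :
    closedLoop A B S R P' = closedLoop A B S R P - B * R⁻¹ * Bᵀ * (P' - P) := by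
  simp only [closedLoop, Matrix.mul_add, Matrix.mul_sub, Matrix.mul_assoc]
  abel

end

/-! ### Injectivity of the inverse problem -/

theorem eq_of_eq_smul_of_det_eq_one {R₁ R₂ : Matrix (Fin m) (Fin m) ℝ} (h₁ : R₁.PosDef)
    (h₂ : R₂.PosDef) (hd₁ : R₁.det = 1) (hd₂ : R₂.det = 1) {c : ℝ} (h : R₂ = c • R₁) :
    R₂ = R₁ := by
  rcases Nat.eq_zero_or_pos m with rfl | hm
  · exact Subsingleton.elim _ _
  have hc : 0 < c := by
    have h1 := h₁.diag_pos (i := ⟨0, hm⟩)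
    have h2 := h₂.diag_pos (i := ⟨0, hm⟩)
    rw [h, Matrix.smul_apply, smul_eq_mul] at h2
    exact pos_of_mul_pos_left h2 h1.le
  have hd := congrArg Matrix.det h
  rw [Matrix.det_smul, hd₁, hd₂, mul_one, Fintype.card_fin] at hd
  rw [h, (pow_eq_one_iff_of_nonneg hc.le hm.ne').1 hd.symm, one_smul]

theorem exists_smul_det_eq_one {R : Matrix (Fin m) (Fin m) ℝ} (hR : R.PosDef) :
    ∃ r : ℝ, 0 < r ∧ (r • R).det = 1 := by
  rcases Nat.eq_zero_or_pos m with rfl | hm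
  · exact ⟨1, one_pos, Matrix.det_fin_zero⟩
  refine ⟨(R.det ^ (m : ℝ)⁻¹)⁻¹, inv_pos.2 (Real.rpow_pos_of_pos hR.det_pos _), ?_⟩
  rw [Matrix.det_smul, Fintype.card_fin, inv_pow, Real.rpow_inv_natCast_pow hR.det_pos.le hm.ne',
    inv_mul_cancel₀ hR.det_pos.ne']

/-- The canonical cost with a prescribed synthesis is unique, unless the pair of closed-loop
matrices is decomposable. -/
theorem existsUnique_canonical {A : Matrix (Fin n) (Fin n) ℝ} {B : Matrix (Fin n) (Fin m) ℝ}
    (hAB : IsControllablePair A B) {Q : Matrix (Fin n) (Fin n) ℝ} {S : Matrix (Fin n) (Fin m) ℝ}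
    {R : Matrix (Fin m) (Fin m) ℝ} {p : Matrix (Fin n) (Fin n) ℝ × Matrix (Fin n) (Fin n) ℝ}
    (hc : IsAdmissibleCost A B Q S R) (hp : IsSynthesisPair A B Q S R p.1 p.2)
    (hpJ : p ∈ synthesisPairs A B \ productPairs A B) :
    ∃! d : Matrix (Fin m) (Fin n) ℝ × Matrix (Fin m) (Fin m) ℝ,
      IsCanonical A B d.1 d.2 ∧
      optimalSynthesis A B (canonicalCost d.1 d.2) =
        optimalSynthesis A B (quadraticCost Q S R) := by
  obtain ⟨⟨P, hP, hFP, hF⟩, ⟨P', hP', hGP, hG⟩⟩ := hp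
  have hR := hc.posDef
  obtain ⟨r, hr, hdet⟩ := exists_smul_det_eq_one hR
  have hFK : p.1 = A - B * (R⁻¹ * (Sᵀ + Bᵀ * P)) := hFP.trans closedLoop_eq
  have hsyn := optimalSynthesis_quadraticCost hR hP hr
  have hstab : IsAsympStable (A - B * (R⁻¹ * (Sᵀ + Bᵀ * P))) := hFK ▸ hF
  have hrR : (r • R).PosDef := hR.smul hr
  refine ⟨(R⁻¹ * (Sᵀ + Bᵀ * P), r • R), ⟨⟨hrR, hdet, hstab⟩, hsyn⟩, ?_⟩
  rintro ⟨K₂, R₂⟩ ⟨hcan, hsyn₂⟩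
  obtain ⟨hK, N, hNF, hNB⟩ := eq_and_exists_intertwiner hAB hrR hcan.posDef hstab hcan.stable
    (hsyn.trans hsyn₂.symm)
  refine Prod.ext hK.symm ?_
  have hNB' : N * B = B * (R⁻¹ * (r⁻¹ • R₂)) := by
    have : Invertible r := invertibleOfNonzero hr.ne'
    rw [hNB, Matrix.inv_smul R r ((Matrix.isUnit_iff_isUnit_det _).1 hR.isUnit), invOf_eq_inv,
      Matrix.smul_mul, Matrix.mul_smul R⁻¹]
  rw [← hFK] at hNF
  have hreach : IsReachable p.1 B := hFK ▸ hAB.isReachable.feedback _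
  rcases eq_smul_or_exists_isCompl hF hG hreach hAB.mulVec_injective hR
    (hcan.posDef.smul (inv_pos.2 hr)) (by rw [hGP, hFP]; exact closedLoop_sub P')
    (by rw [hFP]; exact hP.sub hR hP') hNF hNB' with ⟨c, hcR⟩ | hdec
  · refine eq_of_eq_smul_of_det_eq_one hrR hcan.posDef hdet hcan.det_eq_one (c := c) ?_
    rw [smul_comm, ← hcR, smul_smul, mul_inv_cancel₀ hr.ne', one_smul]
  · exact absurd ⟨hpJ.1, hdec⟩ hpJ.2

end LQ

namespace LQ

variable {n m : ℕ}

/-! ### The Lyapunov equation -/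

theorem exists_lyapunov {F : Matrix (Fin n) (Fin n) ℝ} (hF : IsAsympStable F)
    (W : Matrix (Fin n) (Fin n) ℝ) : ∃ X, F * X + X * Fᵀ = W := by
  have hinj : Function.Injective
      (LinearMap.mulLeft ℝ F + LinearMap.mulRight ℝ Fᵀ : Module.End ℝ (Matrix (Fin n) (Fin n) ℝ)) := by
    rw [injective_iff_map_eq_zero]
    exact fun X hX => eq_zero_of_lyapunov hF hF.transpose hX
  exact LinearMap.injective_iff_surjective.1 hinj W

theorem lyapunov_unique {F X Y : Matrix (Fin n) (Fin n) ℝ} (hF : IsAsympStable F)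
    (h : F * X + X * Fᵀ = F * Y + Y * Fᵀ) : X = Y := by
  rw [← sub_eq_zero]
  apply eq_zero_of_lyapunov hF hF.transpose
  rw [Matrix.mul_sub, Matrix.sub_mul, sub_add_sub_comm, h, sub_self]

theorem isSymm_of_lyapunov {F X W : Matrix (Fin n) (Fin n) ℝ} (hF : IsAsympStable F)
    (hW : Wᵀ = W) (h : F * X + X * Fᵀ = W) : Xᵀ = X := by
  refine lyapunov_unique hF ?_
  have := congrArg Matrix.transpose h
  rw [Matrix.transpose_add, Matrix.transpose_mul, Matrix.transpose_mul, Matrix.transpose_transpose,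
    hW, ← h, add_comm] at this
  exact this

/-- The solution `X` of a Lyapunov equation with positive semidefinite right-hand side `W` is
invertible in the observable case: its kernel lies in that of `W`, and is invariant by `Fᵀ`. -/
theorem isUnit_of_lyapunov {F X W : Matrix (Fin n) (Fin n) ℝ} (hF : IsAsympStable F)
    (hW : W.PosSemidef) (h : F * X + X * Fᵀ = W)
    (hobs : ∀ w : Fin n → ℝ, (∀ k : ℕ, W *ᵥ (Fᵀ ^ k *ᵥ w) = 0) → w = 0) : IsUnit X := by
  have hX : Xᵀ = X := isSymm_of_lyapunov hF hW.isHermitian h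
  have hstep : ∀ w, X *ᵥ w = 0 → W *ᵥ w = 0 ∧ X *ᵥ (Fᵀ *ᵥ w) = 0 := by
    intro w hw
    have e : W *ᵥ w = X *ᵥ (Fᵀ *ᵥ w) := by
      rw [← h, Matrix.add_mulVec, ← Matrix.mulVec_mulVec, hw, Matrix.mulVec_zero, zero_add,
        Matrix.mulVec_mulVec]
    have hz : W *ᵥ w = 0 := by
      rw [← hW.dotProduct_mulVec_zero_iff, star_trivial, e, Matrix.dotProduct_mulVec,
        ← Matrix.mulVec_transpose, hX, hw, zero_dotProduct]
    exact ⟨hz, e ▸ hz⟩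
  rw [← Matrix.mulVec_injective_iff_isUnit]
  refine (injective_iff_map_eq_zero' (Matrix.mulVecLin X)).2 fun w => ⟨fun hw => ?_, fun hw => by
    simp [hw]⟩
  have hk : ∀ k : ℕ, X *ᵥ (Fᵀ ^ k *ᵥ w) = 0 := by
    intro k
    induction k with
    | zero => simpa using hw
    | succ k ih => rw [pow_succ', ← Matrix.mulVec_mulVec]; exact (hstep _ ih).2
  exact hobs w fun k => (hstep _ (hk k)).1

theorem isUnit_of_lyapunov_of_isReachable {F X : Matrix (Fin n) (Fin n) ℝ}
    {B : Matrix (Fin n) (Fin m) ℝ} {R : Matrix (Fin m) (Fin m) ℝ} (hF : IsAsympStable F)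
    (hFB : IsReachable F B) (hR : R.PosDef) (h : F * X + X * Fᵀ = B * R⁻¹ * Bᵀ) : IsUnit X := by
  refine isUnit_of_lyapunov hF ?_ h fun w hw => hFB _ fun k => ?_
  · exact hR.inv.posSemidef.mul_mul_conjTranspose_same B
  · have := transpose_mulVec_eq_zero_of_dotProduct (B := B) hR (p := Fᵀ ^ k *ᵥ w)
      (by rw [hw, dotProduct_zero])
    rwa [← Matrix.transpose_pow, Matrix.mulVec_transpose, Matrix.mulVec_transpose,
      Matrix.vecMul_vecMul] at this

/-! ### Description of the set of synthesis pairs -/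

/-- Every synthesis pair comes from the solution of a Lyapunov equation, the inverse of the
difference of the two extremal solutions of the Riccati equation. -/
theorem exists_lyapunov_of_mem_synthesisPairs {A : Matrix (Fin n) (Fin n) ℝ}
    {B : Matrix (Fin n) (Fin m) ℝ} {p : Matrix (Fin n) (Fin n) ℝ × Matrix (Fin n) (Fin n) ℝ}
    (hp : p ∈ synthesisPairs A B) :
    ∃ (K : Matrix (Fin m) (Fin n) ℝ) (R : Matrix (Fin m) (Fin m) ℝ) (X : Matrix (Fin n) (Fin n) ℝ),
      R.PosDef ∧ IsAsympStable (A - B * K) ∧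
      (A - B * K) * X + X * (A - B * K)ᵀ = B * R⁻¹ * Bᵀ ∧
      p = (A - B * K, A - B * K - B * R⁻¹ * Bᵀ * X⁻¹) := by
  obtain ⟨Q, S, R, hc, ⟨P, hP, hFP, hF⟩, ⟨P', hP', hGP, hG⟩⟩ := hp
  have hR := hc.posDef
  have hD := hP.sub hR hP'
  rw [closedLoop_sub, ← hFP] at hGP
  rw [← hFP] at hD
  have hDu := isUnit_of_stable_antistable hF hG hGP hD
  have hDd := (Matrix.isUnit_iff_isUnit_det _).1 hDu
  have hFK : p.1 = A - B * (R⁻¹ * (Sᵀ + Bᵀ * P)) := hFP.trans closedLoop_eq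
  refine ⟨R⁻¹ * (Sᵀ + Bᵀ * P), R, (P' - P)⁻¹, hR, hFK ▸ hF, ?_, ?_⟩
  · rw [← hFK]
    exact lyapunov_of_riccati (Matrix.nonsing_inv_mul _ hDd) hD
  · rw [← hFK, Matrix.nonsing_inv_nonsing_inv _ hDd]
    exact Prod.ext rfl hGP

/-- The Hamiltonian matrix of a canonical cost is block triangular. -/
theorem hamiltonian_canonical {A : Matrix (Fin n) (Fin n) ℝ}
    {B : Matrix (Fin n) (Fin m) ℝ} {K : Matrix (Fin m) (Fin n) ℝ} {R : Matrix (Fin m) (Fin m) ℝ}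
    (hR : R.PosDef) :
    hamiltonian A B (Kᵀ * R * K) (Kᵀ * R) R =
      Matrix.fromBlocks (A - B * K) (B * R⁻¹ * Bᵀ) 0 (-(A - B * K)ᵀ) := by
  have hRd := (Matrix.isUnit_iff_isUnit_det _).1 hR.isUnit
  have hRT : Rᵀ = R := hR.isHermitian
  have e1 : B * R⁻¹ * (R * K) = B * K := by
    rw [← Matrix.mul_assoc, Matrix.mul_assoc B, Matrix.nonsing_inv_mul _ hRd, Matrix.mul_one]
  have e2 : Kᵀ * R * R⁻¹ = Kᵀ := by
    rw [Matrix.mul_assoc, Matrix.mul_nonsing_inv _ hRd, Matrix.mul_one]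
  rw [hamiltonian, Matrix.transpose_mul, Matrix.transpose_transpose, hRT, e1, e2,
    ← Matrix.mul_assoc, sub_self, Matrix.transpose_sub, Matrix.transpose_mul, neg_sub, neg_add_eq_sub]

/-- The pairs `(F, F - W X⁻¹)`, where `F = A - B K` is stable, `W = B R⁻¹ Bᵀ`, and `X` solves the
Lyapunov equation `F X + X Fᵀ = W`, are attached to the canonical cost of data `(K, R)`. -/
theorem mem_synthesisPairs_of_lyapunov {A : Matrix (Fin n) (Fin n) ℝ}
    {B : Matrix (Fin n) (Fin m) ℝ} (hAB : IsControllablePair A B) {K : Matrix (Fin m) (Fin n) ℝ}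
    {R : Matrix (Fin m) (Fin m) ℝ} {X : Matrix (Fin n) (Fin n) ℝ} (hR : R.PosDef)
    (hF : IsAsympStable (A - B * K))
    (h : (A - B * K) * X + X * (A - B * K)ᵀ = B * R⁻¹ * Bᵀ) :
    (A - B * K, A - B * K - B * R⁻¹ * Bᵀ * X⁻¹) ∈ synthesisPairs A B := by
  have hRd := (Matrix.isUnit_iff_isUnit_det _).1 hR.isUnit
  have hRT : Rᵀ = R := hR.isHermitian
  have hRiT : (R⁻¹)ᵀ = R⁻¹ := hR.inv.isHermitian
  have hXu := isUnit_of_lyapunov_of_isReachable hF (hAB.isReachable.feedback K) hR h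
  have hXd := (Matrix.isUnit_iff_isUnit_det _).1 hXu
  have hXT : Xᵀ = X := isSymm_of_lyapunov hF (by
    simp [Matrix.transpose_mul, hRiT, Matrix.mul_assoc]) h
  have e1 : R⁻¹ * (R * K) = K := by
    rw [← Matrix.mul_assoc, Matrix.nonsing_inv_mul _ hRd, Matrix.one_mul]
  have hT : (Kᵀ * R)ᵀ = R * K := by
    rw [Matrix.transpose_mul, Matrix.transpose_transpose, hRT]
  have hcl : ∀ P, closedLoop A B (Kᵀ * R) R P = A - B * K - B * R⁻¹ * Bᵀ * P := fun P => by
    rw [closedLoop_eq, hT, Matrix.mul_add, e1, Matrix.mul_add, ← sub_sub]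
    simp only [Matrix.mul_assoc]
  have hric : ∀ P : Matrix (Fin n) (Fin n) ℝ,
      P * A + Aᵀ * P - (Kᵀ * R + P * B) * R⁻¹ * ((Kᵀ * R)ᵀ + Bᵀ * P) + Kᵀ * R * K =
      P * (A - B * K) + (A - B * K)ᵀ * P - P * (B * R⁻¹ * Bᵀ) * P := fun P => by
    have e2 : (Kᵀ * R + P * B) * R⁻¹ * (R * K + Bᵀ * P) =
        (Kᵀ * R + P * B) * K + Kᵀ * Bᵀ * P + P * B * R⁻¹ * Bᵀ * P := by
      have e3 : Kᵀ * R * R⁻¹ = Kᵀ := by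
        rw [Matrix.mul_assoc, Matrix.mul_nonsing_inv _ hRd, Matrix.mul_one]
      rw [Matrix.mul_add, Matrix.mul_assoc, e1, Matrix.add_mul _ _ R⁻¹, e3,
        Matrix.add_mul Kᵀ]
      simp only [Matrix.mul_assoc, add_assoc]
    rw [hT, e2]
    simp only [Matrix.transpose_sub, Matrix.transpose_mul, Matrix.add_mul, Matrix.mul_sub,
      Matrix.sub_mul, Matrix.mul_assoc]
    abel
  refine ⟨Kᵀ * R * K, Kᵀ * R, R, ⟨?_, hR, ?_⟩, ⟨0, ⟨Matrix.isSymm_zero, ?_⟩, ?_, hF⟩,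
    ⟨X⁻¹, ⟨?_, ?_⟩, (hcl _).symm, ?_⟩⟩
  · rw [Matrix.IsSymm, Matrix.transpose_mul, Matrix.transpose_mul, Matrix.transpose_transpose, hRT,
      Matrix.mul_assoc]
  · intro z hz
    rw [hamiltonian_canonical hR, Matrix.fromBlocks_map,
      Matrix.mem_spectrum_iff_isRoot_charpoly, Matrix.map_zero _ (map_zero _),
      Matrix.charpoly_fromBlocks_zero₂₁, Polynomial.root_mul,
      ← Matrix.mem_spectrum_iff_isRoot_charpoly, ← Matrix.mem_spectrum_iff_isRoot_charpoly] at hz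
    rcases hz with hz | hz
    · exact (hF z hz).ne
    · exact (hF.transpose.neg z hz).ne'
  · rw [hric]; simp
  · rw [hcl, Matrix.mul_zero, sub_zero]
  · rw [Matrix.IsSymm, Matrix.transpose_nonsing_inv, hXT]
  · rw [hric, ← h]
    simp only [Matrix.mul_add, Matrix.add_mul, Matrix.mul_assoc, Matrix.mul_nonsing_inv _ hXd,
      Matrix.mul_one, Matrix.nonsing_inv_mul_cancel_left _ _ hXd]
    abel
  · -- the second closed-loop matrix is `-X Fᵀ X⁻¹`
    have e : A - B * K - B * R⁻¹ * Bᵀ * X⁻¹ = X * (-(A - B * K)ᵀ) * X⁻¹ := by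
      rw [← h, Matrix.add_mul, Matrix.mul_assoc _ X, Matrix.mul_nonsing_inv _ hXd, Matrix.mul_one,
        Matrix.mul_neg, Matrix.neg_mul]
      abel
    intro z hz
    rw [mem_spectrum_map_iff, e] at hz
    have hu := Matrix.charpoly_units_conj hXu.unit (-(A - B * K)ᵀ)
    rw [IsUnit.unit_spec] at hu
    simp only [hu] at hz
    exact hF.transpose.neg z (mem_spectrum_map_iff.2 hz)

/-! ### Single-input controllability -/

/-- `b` is a cyclic vector of `F`, in dual form. -/
def IsCyclicVector (F : Matrix (Fin n) (Fin n) ℝ) (b : Fin n → ℝ) : Prop :=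
  ∀ p : Fin n → ℝ, (∀ k : ℕ, p ⬝ᵥ (F ^ k *ᵥ b) = 0) → p = 0

theorem isCyclicVector_of_det_ne_zero {F : Matrix (Fin n) (Fin n) ℝ} {b : Fin n → ℝ}
    (h : (Matrix.of fun i : Fin n => F ^ (i : ℕ) *ᵥ b).det ≠ 0) : IsCyclicVector F b := by
  intro p hp
  refine Matrix.eq_zero_of_mulVec_eq_zero h ?_
  funext i
  exact (dotProduct_comm _ _).trans (hp i)

/-- In a controllable system, a chain of states `x (i + 1) = A x i + B u`, issued from any
nonzero vector, can be kept linearly independent until it spans the whole space. -/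
theorem exists_independent_chain {A : Matrix (Fin n) (Fin n) ℝ} {B : Matrix (Fin n) (Fin m) ℝ}
    (hAB : IsReachable A B) {b : Fin n → ℝ} (hb : b ≠ 0) (k : ℕ) (hk : k < n) :
    ∃ x : ℕ → Fin n → ℝ, x 0 = b ∧ LinearIndependent ℝ (fun i : Fin (k + 1) => x i) ∧
      ∀ i < k, ∃ u, x (i + 1) = A *ᵥ x i + B *ᵥ u := by
  induction k with
  | zero =>
    refine ⟨fun _ => b, rfl, ?_, by simp⟩
    change LinearIndependent ℝ (fun _ : Fin 1 => b)
    rw [linearIndependent_unique_iff]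
    exact hb
  | succ k ih =>
    obtain ⟨x, hx0, hli, hx⟩ := ih (by omega)
    set L := Submodule.span ℝ (Set.range fun i : Fin (k + 1) => x i) with hL
    have hmem : ∀ i ≤ k, x i ∈ L := fun i hi =>
      Submodule.subset_span ⟨⟨i, by omega⟩, rfl⟩
    obtain ⟨u, hu⟩ : ∃ u, A *ᵥ x k + B *ᵥ u ∉ L := by
      by_contra! hall
      have hAk : A *ᵥ x k ∈ L := by simpa using hall 0
      have hBL : ∀ u, B *ᵥ u ∈ L := fun u => by
        have := L.sub_mem (hall u) hAk
        rwa [add_sub_cancel_left] at this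
      have hAL : ∀ w ∈ L, A *ᵥ w ∈ L := by
        intro w hw
        have hle : L ≤ L.comap (Matrix.mulVecLin A) := by
          rw [hL, Submodule.span_le]
          rintro _ ⟨i, rfl⟩
          change A *ᵥ x i ∈ L
          rcases Nat.lt_or_eq_of_le (Nat.lt_succ_iff.1 i.2) with hi | hi
          · obtain ⟨u, hu⟩ := hx i hi
            rw [← add_sub_cancel_right (A *ᵥ x i) (B *ᵥ u), ← hu]
            exact L.sub_mem (hmem _ hi) (hBL u)
          · rw [hi]; exact hAk
        exact hle hw
      have hpow : ∀ (j : ℕ) (u : Fin m → ℝ), A ^ j *ᵥ (B *ᵥ u) ∈ L := by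
        intro j u
        induction j with
        | zero => simpa using hBL u
        | succ j ih => rw [pow_succ', ← Matrix.mulVec_mulVec]; exact hAL _ ih
      have htop : L = ⊤ := by
        by_contra hne
        obtain ⟨f, hf, hLf⟩ := Submodule.exists_le_ker_of_lt_top L (lt_top_iff_ne_top.2 hne)
        apply hf
        have hfp : ∀ w, f w = (fun i => f (Pi.single i 1)) ⬝ᵥ w := fun w => by
          rw [LinearMap.pi_apply_eq_sum_univ f w]
          simp only [dotProduct, smul_eq_mul, mul_comm]
          exact Finset.sum_congr rfl fun i _ => by congr 2; ext j; simp [Pi.single_apply, eq_comm]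
        have hp : (fun i => f (Pi.single i 1)) = 0 := hAB _ fun j => by
          refine dotProduct_eq_zero _ fun u => ?_
          rw [← Matrix.dotProduct_mulVec, ← hfp, ← Matrix.mulVec_mulVec]
          exact hLf (hpow j u)
        refine LinearMap.ext fun w => ?_
        rw [hfp, hp, zero_dotProduct, LinearMap.zero_apply]
      have hcard := finrank_span_eq_card hli
      rw [← hL, htop, finrank_top, Module.finrank_fin_fun, Fintype.card_fin] at hcard
      omega
    refine ⟨fun i => if i ≤ k then x i else A *ᵥ x k + B *ᵥ u, by simpa using hx0, ?_, ?_⟩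
    · have heq : (fun i : Fin (k + 1 + 1) =>
          if (i : ℕ) ≤ k then x i else A *ᵥ x k + B *ᵥ u) =
          Fin.snoc (fun i : Fin (k + 1) => x i) (A *ᵥ x k + B *ᵥ u) := ?_
      · rw [heq]
        exact hli.finSnoc hu
      funext i
      refine Fin.lastCases ?_ (fun i => ?_) i
      · simp
      · simp [Nat.lt_succ_iff.1 i.2]
    · intro i hi
      rcases Nat.lt_or_eq_of_le (Nat.lt_succ_iff.1 hi) with h | rfl
      · simpa [h.le, Nat.succ_le_of_lt h] using hx i h
      · exact ⟨u, by simp⟩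

/-- Heymann's lemma: a controllable system becomes controllable from any single nonzero vector,
taken as the only input direction, after a suitable feedback. -/
theorem exists_feedback_det_ne_zero {A : Matrix (Fin n) (Fin n) ℝ} {B : Matrix (Fin n) (Fin m) ℝ}
    (hAB : IsReachable A B) {b : Fin n → ℝ} (hb : b ≠ 0) :
    ∃ K : Matrix (Fin m) (Fin n) ℝ,
      (Matrix.of fun i : Fin n => (A - B * K) ^ (i : ℕ) *ᵥ b).det ≠ 0 := by
  obtain ⟨k, rfl⟩ : ∃ k, n = k + 1 := by
    rcases n with _ | k
    · exact absurd (Subsingleton.elim _ _) hb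
    · exact ⟨k, rfl⟩
  obtain ⟨x, hx0, hli, hx⟩ := exists_independent_chain hAB hb k (Nat.lt_succ_self k)
  choose! u hu using hx
  set e := basisOfLinearIndependentOfCardEqFinrank hli (by simp) with he
  set K : Matrix (Fin m) (Fin (k + 1)) ℝ :=
    LinearMap.toMatrix' (e.constr ℝ fun i : Fin (k + 1) => -u i) with hK
  have hKx : ∀ i < k, K *ᵥ x i = -u i := by
    intro i hi
    have := e.constr_basis ℝ (fun i : Fin (k + 1) => -u i) ⟨i, by omega⟩
    rw [he, coe_basisOfLinearIndependentOfCardEqFinrank] at this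
    rw [hK, LinearMap.toMatrix'_mulVec]
    exact this
  have hpow : ∀ i ≤ k, (A - B * K) ^ i *ᵥ b = x i := by
    intro i
    induction i with
    | zero => intro _; simp [hx0]
    | succ i ih =>
      intro hi
      rw [pow_succ', ← Matrix.mulVec_mulVec, ih (by omega), Matrix.sub_mulVec,
        ← Matrix.mulVec_mulVec, hKx i hi, Matrix.mulVec_neg, sub_neg_eq_add, hu i hi]
  refine ⟨K, ?_⟩
  have hrow : (Matrix.of fun i : Fin (k + 1) => (A - B * K) ^ (i : ℕ) *ᵥ b) =
      Matrix.of fun i : Fin (k + 1) => x i := by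
    congr 1
    funext i
    exact hpow i (Nat.lt_succ_iff.1 i.2)
  rw [hrow]
  have := (Matrix.linearIndependent_rows_iff_isUnit
    (A := Matrix.of fun i : Fin (k + 1) => x i)).1 hli
  exact ((Matrix.isUnit_iff_isUnit_det _).1 this).ne_zero

open Polynomial in
/-- The determinant of the controllability matrix is polynomial along lines. -/
theorem exists_polynomial_det (F₀ F₁ : Matrix (Fin n) (Fin n) ℝ) (b : Fin n → ℝ) :
    ∃ q : ℝ[X], ∀ s : ℝ,
      q.eval s = (Matrix.of fun i : Fin n => (F₀ + s • F₁) ^ (i : ℕ) *ᵥ b).det := by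
  refine ⟨(Matrix.of fun i : Fin n =>
    ((C : ℝ →+* ℝ[X]).mapMatrix F₀ + (X : ℝ[X]) • (C : ℝ →+* ℝ[X]).mapMatrix F₁) ^ (i : ℕ) *ᵥ
      fun j => C (b j)).det, fun s => ?_⟩
  have hF : (evalRingHom s).mapMatrix
      ((C : ℝ →+* ℝ[X]).mapMatrix F₀ + (X : ℝ[X]) • (C : ℝ →+* ℝ[X]).mapMatrix F₁) =
      F₀ + s • F₁ := by
    ext i j
    simp only [RingHom.mapMatrix_apply, Matrix.map_apply, Matrix.add_apply, Matrix.smul_apply,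
      smul_eq_mul, map_add, coe_evalRingHom, eval_mul, eval_C, eval_X]
  have hb : (evalRingHom s ∘ fun j => C (b j)) = b := by
    funext j
    simp
  rw [← coe_evalRingHom, RingHom.map_det]
  congr 1
  ext i j
  rw [RingHom.mapMatrix_apply, Matrix.map_apply, Matrix.of_apply, Matrix.of_apply,
    RingHom.map_mulVec, ← RingHom.mapMatrix_apply, map_pow, hF, hb]

open Filter Topology in
theorem eventually_eval_ne_zero {q : Polynomial ℝ} (hq : q ≠ 0) :
    ∀ᶠ s in 𝓝[≠] (0 : ℝ), q.eval s ≠ 0 := by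
  have h := ((q.finite_setOfPred_isRoot hq).sdiff (t := {0})).isClosed.isOpen_compl.mem_nhds
    (x := 0) (by simp)
  filter_upwards [nhdsWithin_le_nhds h, self_mem_nhdsWithin] with s hs hs0 hroot
  exact hs ⟨hroot, hs0⟩

/-! ### Rigid pairs -/

/-- The pair `(F, G)` is rigid if its only common endomorphism of trace zero is `0`, that is, if
only the scalars commute with both members. -/
def IsRigidPair (F G : Matrix (Fin n) (Fin n) ℝ) : Prop :=
  ∀ N : Matrix (Fin n) (Fin n) ℝ, N * F = F * N → N * G = G * N → N.trace = 0 → N = 0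

theorem IsRigidPair.exists_smul {F G N : Matrix (Fin n) (Fin n) ℝ} (h : IsRigidPair F G)
    (hF : N * F = F * N) (hG : N * G = G * N) : ∃ c : ℝ, N = c • 1 := by
  rcases Nat.eq_zero_or_pos n with rfl | hn
  · exact ⟨0, Subsingleton.elim _ _⟩
  refine ⟨N.trace / n, sub_eq_zero.1 (h _ ?_ ?_ ?_)⟩
  · simp [Matrix.sub_mul, Matrix.mul_sub, hF]
  · simp [Matrix.sub_mul, Matrix.mul_sub, hG]
  · have : (n : ℝ) ≠ 0 := by positivity
    simp [Matrix.trace_sub, Matrix.trace_smul, this]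

theorem IsRigidPair.notMem_productPairs {A : Matrix (Fin n) (Fin n) ℝ}
    {B : Matrix (Fin n) (Fin m) ℝ} {p : Matrix (Fin n) (Fin n) ℝ × Matrix (Fin n) (Fin n) ℝ}
    (h : IsRigidPair p.1 p.2) : p ∉ productPairs A B := by
  rintro ⟨-, E₁, E₂, hE, h₁, h₂, hF₁, hF₂, hG₁, hG₂⟩
  set π := E₁.projection E₂ hE with hπ
  have hπ₁ : ∀ v ∈ E₁, π v = v := fun v hv => Submodule.projection_apply_of_mem_left hE hv
  have hπ₂ : ∀ v ∈ E₂, π v = 0 := fun v hv => Submodule.projection_apply_of_mem_right hE hv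
  have hcomm : ∀ M : Matrix (Fin n) (Fin n) ℝ, LeavesInvariant M E₁ → LeavesInvariant M E₂ →
      LinearMap.toMatrix' π * M = M * LinearMap.toMatrix' π := by
    intro M hM₁ hM₂
    apply Matrix.toLin'.injective
    rw [Matrix.toLin'_mul, Matrix.toLin'_mul, Matrix.toLin'_toMatrix']
    refine LinearMap.ext fun v => ?_
    obtain ⟨a, ha, b, hb, rfl⟩ := Submodule.mem_sup.1
      (show v ∈ E₁ ⊔ E₂ by rw [hE.sup_eq_top]; trivial)
    simp only [LinearMap.comp_apply, map_add, Matrix.toLin'_apply, hπ₁ a ha, hπ₂ b hb,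
      hπ₁ _ (hM₁ a ha), hπ₂ _ (hM₂ b hb), Matrix.mulVec_zero]
  obtain ⟨c, hc⟩ := h.exists_smul (hcomm _ hF₁ hF₂) (hcomm _ hG₁ hG₂)
  have hv : ∀ v, π v = c • v := fun v => by
    rw [← LinearMap.toMatrix'_mulVec, hc, Matrix.smul_mulVec, Matrix.one_mulVec]
  obtain ⟨a, ha, ha0⟩ := (Submodule.ne_bot_iff _).1 h₁
  obtain ⟨b, hb, hb0⟩ := (Submodule.ne_bot_iff _).1 h₂
  have hc0 : c = 0 := by
    have := hv b
    rw [hπ₂ b hb, eq_comm, smul_eq_zero] at this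
    exact this.resolve_right hb0
  have := hv a
  rw [hπ₁ a ha, hc0, zero_smul] at this
  exact ha0 this

/-- If `T₁` is injective, so is `T₀ + s T₁` for all but finitely many `s`: the exceptions are the
opposites of eigenvalues of `L T₀`, where `L` is a left inverse of `T₁`. -/
theorem finite_not_injective_add_smul {V V' : Type*} [AddCommGroup V] [Module ℝ V]
    [FiniteDimensional ℝ V] [AddCommGroup V'] [Module ℝ V'] (T₀ T₁ : V →ₗ[ℝ] V')
    (h : Function.Injective T₁) : {s : ℝ | ¬ Function.Injective (T₀ + s • T₁)}.Finite := by
  obtain ⟨L, hL⟩ := T₁.exists_leftInverse_of_injective (LinearMap.ker_eq_bot.2 h)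
  refine ((Module.End.finite_hasEigenvalue (L.comp T₀)).preimage neg_injective.injOn).subset ?_
  intro s hs
  have hs' : ¬ ∀ v, (T₀ + s • T₁) v = 0 → v = 0 := fun hall =>
    hs ((injective_iff_map_eq_zero _).2 hall)
  push Not at hs'
  obtain ⟨v, hv, hv0⟩ := hs'
  refine Module.End.hasEigenvalue_of_hasEigenvector (x := v) ⟨?_, hv0⟩
  rw [Module.End.mem_eigenspace_iff]
  have := congrArg L hv
  have hLv : L (T₁ v) = v := LinearMap.congr_fun hL v
  rw [LinearMap.add_apply, LinearMap.smul_apply, map_add, map_smul, hLv, map_zero] at this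
  rw [LinearMap.comp_apply, neg_smul]
  exact eq_neg_of_add_eq_zero_left this

/-- The linear system in `(N, N')` which expresses that `N` commutes with `F` and `W X⁻¹` and has
trace zero, with `N' = X⁻¹ N X` as an auxiliary unknown which makes it affine in `(W, X)`. -/
def commutantSystem (F W X : Matrix (Fin n) (Fin n) ℝ) :
    Matrix (Fin n) (Fin n) ℝ × Matrix (Fin n) (Fin n) ℝ →ₗ[ℝ]
      Matrix (Fin n) (Fin n) ℝ × Matrix (Fin n) (Fin n) ℝ × Matrix (Fin n) (Fin n) ℝ × ℝ where
  toFun N := (N.1 * F - F * N.1, N.1 * W - W * N.2, N.1 * X - X * N.2, N.1.trace)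
  map_add' N N' := by
    simp only [Prod.fst_add, Prod.snd_add, Matrix.add_mul, Matrix.mul_add, Matrix.trace_add,
      Prod.mk_add_mk, Prod.mk.injEq]
    refine ⟨?_, ?_, ?_, trivial⟩ <;> abel
  map_smul' c N := by
    simp [Matrix.trace_smul, smul_sub]

theorem isRigidPair_of_injective {F W X : Matrix (Fin n) (Fin n) ℝ} (hX : IsUnit X)
    (h : ∀ N, commutantSystem F W X N = 0 → N = 0) : IsRigidPair F (F - W * X⁻¹) := by
  intro N hF hG htr
  have hXd := (Matrix.isUnit_iff_isUnit_det _).1 hX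
  have hW : N * (W * X⁻¹) = W * X⁻¹ * N := by
    rw [Matrix.mul_sub, Matrix.sub_mul, hF] at hG
    exact sub_right_injective hG
  refine congrArg Prod.fst (h (N, X⁻¹ * N * X) ?_)
  have e1 : N * W = W * (X⁻¹ * N * X) := by
    rw [← Matrix.mul_assoc, ← Matrix.mul_assoc, ← hW, Matrix.mul_assoc, Matrix.mul_assoc W,
      Matrix.nonsing_inv_mul _ hXd, Matrix.mul_one]
  have e2 : N * X = X * (X⁻¹ * N * X) := by
    rw [← Matrix.mul_assoc, ← Matrix.mul_assoc, Matrix.mul_nonsing_inv _ hXd, Matrix.one_mul]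
  simp only [commutantSystem, LinearMap.coe_mk, AddHom.coe_mk, hF, sub_self, ← e1, ← e2, htr]
  rfl

/-- Rigidity in the single-input case `W = b bᵀ`, where `b` is a cyclic vector: an endomorphism `N`
as above has `b` as an eigenvector, hence is a scalar. -/
theorem commutantSystem_injective {F X : Matrix (Fin n) (Fin n) ℝ} {b : Fin n → ℝ}
    (hb0 : b ≠ 0) (hb : IsCyclicVector F b) (hX : IsUnit X) :
    Function.Injective (commutantSystem F (Matrix.vecMulVec b b) X) := by
  rw [injective_iff_map_eq_zero]
  rintro ⟨N, N'⟩ h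
  simp only [commutantSystem, LinearMap.coe_mk, AddHom.coe_mk, Prod.mk_eq_zero, sub_eq_zero] at h
  obtain ⟨hF, hW, hXN, htr⟩ := h
  have hXd := (Matrix.isUnit_iff_isUnit_det _).1 hX
  have hbb : b ⬝ᵥ b ≠ 0 := by simpa using hb0
  obtain ⟨c, hc⟩ : ∃ c : ℝ, N *ᵥ b = c • b := by
    refine ⟨(b ⬝ᵥ N' *ᵥ b) / (b ⬝ᵥ b), ?_⟩
    have := congrArg (· *ᵥ b) hW
    simp only [← Matrix.mulVec_mulVec, Matrix.vecMulVec_mulVec, Matrix.mulVec_smul] at this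
    rw [div_eq_inv_mul, mul_smul]
    have h2 : (b ⬝ᵥ b) • (N *ᵥ b) = (b ⬝ᵥ N' *ᵥ b) • b := by simpa using this
    rw [← h2, smul_smul, inv_mul_cancel₀ hbb, one_smul]
  have hNc : N - c • 1 = 0 := by
    ext i j
    have hrow : (N - c • 1) i = 0 := hb _ fun k => by
      have hcomm : N * F ^ k = F ^ k * N := ((show Commute N F from hF).pow_right k).eq
      have : (N - c • 1) *ᵥ (F ^ k *ᵥ b) = 0 := by
        rw [Matrix.sub_mulVec, Matrix.mulVec_mulVec, hcomm, ← Matrix.mulVec_mulVec, hc,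
          Matrix.mulVec_smul, Matrix.smul_mulVec, Matrix.one_mulVec, sub_self]
      exact congrFun this i
    exact congrFun hrow j
  have hNc := sub_eq_zero.1 hNc
  have hn : (n : ℝ) ≠ 0 := by
    rcases Nat.eq_zero_or_pos n with rfl | hn
    · exact absurd (Subsingleton.elim _ _) hb0
    · positivity
  have hc0 : c = 0 := by
    rw [hNc, Matrix.trace_smul, Matrix.trace_one, Fintype.card_fin, smul_eq_mul] at htr
    exact (mul_eq_zero.1 htr).resolve_right hn
  have hN : N = 0 := by rw [hNc, hc0, zero_smul]
  refine Prod.ext hN ?_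
  rw [hN, Matrix.zero_mul, eq_comm] at hXN
  have := congrArg (X⁻¹ * ·) hXN
  simpa [← Matrix.mul_assoc, Matrix.nonsing_inv_mul _ hXd] using this

end LQ

namespace LQ

variable {n m : ℕ}

open Filter Topology

/-! ### Genericity of rigid pairs -/

section

attribute [local instance] Matrix.linftyOpNormedRing Matrix.linftyOpNormedAlgebra

/-- Stability is an open condition: the spectrum is upper hemicontinuous. -/
theorem IsAsympStable.eventually {F : Matrix (Fin n) (Fin n) ℝ} (hF : IsAsympStable F) :
    ∀ᶠ F' in 𝓝 F, IsAsympStable F' := by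
  have h := upperHemicontinuous_iff_forall_isOpen.1
    (upperHemicontinuous_spectrum ℂ (Matrix (Fin n) (Fin n) ℂ)) (F.map (algebraMap ℝ ℂ))
    {z : ℂ | z.re < 0} (isOpen_lt Complex.continuous_re continuous_const) hF
  have hc : Continuous fun F' : Matrix (Fin n) (Fin n) ℝ => F'.map (algebraMap ℝ ℂ) :=
    continuous_id.matrix_map Complex.continuous_ofReal
  exact hc.continuousAt.eventually h

end

section

attribute [local instance] Matrix.normedAddCommGroup Matrix.normedSpace

/-- Rigidity is the injectivity of the linear map `N ↦ (N F - F N, N G - G N, trace N)`, which is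
expressed by its values on the matrix units. -/
theorem isRigidPair_iff_linearIndependent (F G : Matrix (Fin n) (Fin n) ℝ) :
    IsRigidPair F G ↔ LinearIndependent ℝ fun ij : Fin n × Fin n =>
      (Matrix.single ij.1 ij.2 (1 : ℝ) * F - F * Matrix.single ij.1 ij.2 (1 : ℝ),
        Matrix.single ij.1 ij.2 (1 : ℝ) * G - G * Matrix.single ij.1 ij.2 (1 : ℝ),
        (Matrix.single ij.1 ij.2 (1 : ℝ)).trace) := by
  have hsum : ∀ N : Matrix (Fin n) (Fin n) ℝ,
      ∑ ij : Fin n × Fin n, N ij.1 ij.2 •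
      (Matrix.single ij.1 ij.2 (1 : ℝ) * F - F * Matrix.single ij.1 ij.2 (1 : ℝ),
        Matrix.single ij.1 ij.2 (1 : ℝ) * G - G * Matrix.single ij.1 ij.2 (1 : ℝ),
        (Matrix.single ij.1 ij.2 (1 : ℝ)).trace) = (N * F - F * N, N * G - G * N, N.trace) := by
    intro N
    have hN : N = ∑ ij : Fin n × Fin n, N ij.1 ij.2 • Matrix.single ij.1 ij.2 (1 : ℝ) := by
      rw [Fintype.sum_prod_type]
      conv_lhs => rw [Matrix.matrix_eq_sum_single N]
      simp
    conv_rhs => rw [hN]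
    simp only [Matrix.sum_mul, Matrix.mul_sum, Matrix.trace_sum, ← Finset.sum_sub_distrib,
      Matrix.smul_mul, Matrix.mul_smul, ← smul_sub, Matrix.trace_smul]
    refine Prod.ext ?_ (Prod.ext ?_ ?_)
    · simp only [Prod.fst_sum, Prod.smul_fst]
    · simp only [Prod.snd_sum, Prod.fst_sum, Prod.smul_snd, Prod.smul_fst]
    · simp only [Prod.snd_sum, Prod.smul_snd]
  rw [Fintype.linearIndependent_iff]
  constructor
  · intro h g hg ij
    have e := hsum (Matrix.of fun i j => g (i, j))
    simp only [Matrix.of_apply, Prod.mk.eta] at e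
    rw [hg, eq_comm, Prod.mk_eq_zero, Prod.mk_eq_zero] at e
    have := h _ (sub_eq_zero.1 e.1) (sub_eq_zero.1 e.2.1) e.2.2
    exact congrFun (congrFun this ij.1) ij.2
  · intro h N hF hG htr
    ext i j
    refine h (fun ij => N ij.1 ij.2) ?_ (i, j)
    rw [hsum, hF, hG, htr, sub_self, sub_self]
    rfl

theorem isOpen_isRigidPair :
    IsOpen {p : Matrix (Fin n) (Fin n) ℝ × Matrix (Fin n) (Fin n) ℝ | IsRigidPair p.1 p.2} := by
  simp only [isRigidPair_iff_linearIndependent]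
  refine (isOpen_setOfPred_linearIndependent (𝕜 := ℝ)
    (E := Matrix (Fin n) (Fin n) ℝ × Matrix (Fin n) (Fin n) ℝ × ℝ)
    (ι := Fin n × Fin n)).preimage (continuous_pi fun ij => ?_)
  fun_prop

end

open scoped Kronecker in
/-- The matrix of the Lyapunov operator `X ↦ F X + X Fᵀ`. -/
def lyapunovMatrix (F : Matrix (Fin n) (Fin n) ℝ) :
    Matrix (Fin n × Fin n) (Fin n × Fin n) ℝ :=
  (1 : Matrix (Fin n) (Fin n) ℝ) ⊗ₖ F + F ⊗ₖ (1 : Matrix (Fin n) (Fin n) ℝ)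

theorem lyapunovMatrix_mulVec_vec (F X : Matrix (Fin n) (Fin n) ℝ) :
    lyapunovMatrix F *ᵥ X.vec = (F * X + X * Fᵀ).vec := by
  rw [lyapunovMatrix, Matrix.add_mulVec, Matrix.kronecker_mulVec_vec, Matrix.kronecker_mulVec_vec,
    Matrix.transpose_one, Matrix.mul_one, Matrix.one_mul, Matrix.vec_add]

theorem isUnit_lyapunovMatrix {F : Matrix (Fin n) (Fin n) ℝ} (hF : IsAsympStable F) :
    IsUnit (lyapunovMatrix F) := by
  rw [← Matrix.mulVec_injective_iff_isUnit]
  refine (injective_iff_map_eq_zero' (Matrix.mulVecLin (lyapunovMatrix F))).2 fun w =>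
    ⟨fun hw => ?_, fun hw => by simp [hw]⟩
  obtain ⟨X, rfl⟩ := Matrix.vec_bijective.2 w
  rw [Matrix.mulVecLin_apply, lyapunovMatrix_mulVec_vec, ← Matrix.vec_zero, Matrix.vec_inj] at hw
  rw [eq_zero_of_lyapunov hF hF.transpose hw, Matrix.vec_zero]

/-- The solution `X` of the Lyapunov equation `F X + X Fᵀ = W`, for a stable matrix `F`. -/
noncomputable def lyapunovSolution (F W : Matrix (Fin n) (Fin n) ℝ) : Matrix (Fin n) (Fin n) ℝ :=
  Matrix.of fun i j => ((lyapunovMatrix F)⁻¹ *ᵥ W.vec) (j, i)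

theorem eq_lyapunovSolution {F X W : Matrix (Fin n) (Fin n) ℝ} (hF : IsAsympStable F)
    (h : F * X + X * Fᵀ = W) : X = lyapunovSolution F W := by
  have hd := (Matrix.isUnit_iff_isUnit_det _).1 (isUnit_lyapunovMatrix hF)
  ext i j
  rw [lyapunovSolution, Matrix.of_apply, ← h, ← lyapunovMatrix_mulVec_vec, Matrix.mulVec_mulVec,
    Matrix.nonsing_inv_mul _ hd, Matrix.one_mulVec]
  rfl

theorem lyapunovSolution_spec {F : Matrix (Fin n) (Fin n) ℝ} (hF : IsAsympStable F)
    (W : Matrix (Fin n) (Fin n) ℝ) :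
    F * lyapunovSolution F W + lyapunovSolution F W * Fᵀ = W := by
  obtain ⟨X, hX⟩ := exists_lyapunov hF W
  rw [← eq_lyapunovSolution hF hX, hX]

theorem continuousAt_inv_of_isUnit {ι : Type*} [Fintype ι] [DecidableEq ι] {M : Matrix ι ι ℝ}
    (h : IsUnit M) : ContinuousAt Inv.inv M := by
  refine continuousAt_matrix_inv M ?_
  rw [Ring.inverse_eq_inv']
  exact continuousAt_inv₀ ((Matrix.isUnit_iff_isUnit_det _).1 h).ne_zero

theorem continuousAt_lyapunovSolution {F : Matrix (Fin n) (Fin n) ℝ} (hF : IsAsympStable F)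
    (W : Matrix (Fin n) (Fin n) ℝ) :
    ContinuousAt (fun q : Matrix (Fin n) (Fin n) ℝ × Matrix (Fin n) (Fin n) ℝ =>
      lyapunovSolution q.1 q.2) (F, W) := by
  have h1 : Continuous fun q : Matrix (Fin n) (Fin n) ℝ × Matrix (Fin n) (Fin n) ℝ =>
      lyapunovMatrix q.1 := by
    refine continuous_matrix fun i j => ?_
    simp only [lyapunovMatrix, Matrix.add_apply, Matrix.kroneckerMap_apply]
    fun_prop
  have h2 : ContinuousAt (fun q : Matrix (Fin n) (Fin n) ℝ × Matrix (Fin n) (Fin n) ℝ =>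
      (lyapunovMatrix q.1)⁻¹) (F, W) :=
    ContinuousAt.comp (f := fun q : Matrix (Fin n) (Fin n) ℝ × Matrix (Fin n) (Fin n) ℝ =>
      lyapunovMatrix q.1) (g := Inv.inv)
      (continuousAt_inv_of_isUnit (isUnit_lyapunovMatrix hF)) h1.continuousAt
  refine continuousAt_pi.2 fun i => continuousAt_pi.2 fun j => ?_
  have h3 : Continuous fun M : Matrix (Fin n × Fin n) (Fin n × Fin n) ℝ ×
      Matrix (Fin n) (Fin n) ℝ => (M.1 *ᵥ M.2.vec) (j, i) := by
    simp only [Matrix.mulVec, dotProduct, Matrix.vec]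
    fun_prop
  exact ContinuousAt.comp (f := fun q : Matrix (Fin n) (Fin n) ℝ × Matrix (Fin n) (Fin n) ℝ =>
      ((lyapunovMatrix q.1)⁻¹, q.2)) h3.continuousAt (h2.prodMk continuous_snd.continuousAt)

/-- The pair of closed-loop matrices `(F, F - W X⁻¹)`, where `X` solves `F X + X Fᵀ = W`. -/
noncomputable def lyapunovPair (F W : Matrix (Fin n) (Fin n) ℝ) :
    Matrix (Fin n) (Fin n) ℝ × Matrix (Fin n) (Fin n) ℝ :=
  (F, F - W * (lyapunovSolution F W)⁻¹)

theorem continuousAt_lyapunovPair {F W : Matrix (Fin n) (Fin n) ℝ} (hF : IsAsympStable F)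
    (hX : IsUnit (lyapunovSolution F W)) :
    ContinuousAt (fun q : Matrix (Fin n) (Fin n) ℝ × Matrix (Fin n) (Fin n) ℝ =>
      lyapunovPair q.1 q.2) (F, W) := by
  have h1 : ContinuousAt (fun q : Matrix (Fin n) (Fin n) ℝ × Matrix (Fin n) (Fin n) ℝ =>
      (lyapunovSolution q.1 q.2)⁻¹) (F, W) :=
    ContinuousAt.comp (f := fun q : Matrix (Fin n) (Fin n) ℝ × Matrix (Fin n) (Fin n) ℝ =>
      lyapunovSolution q.1 q.2) (g := Inv.inv)
      (continuousAt_inv_of_isUnit hX) (continuousAt_lyapunovSolution hF W)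
  exact continuous_fst.continuousAt.prodMk
    (continuous_fst.continuousAt.sub (continuous_snd.continuousAt.mul h1))

section

variable {A : Matrix (Fin n) (Fin n) ℝ} {B : Matrix (Fin n) (Fin m) ℝ}

theorem lyapunovPair_mem_synthesisPairs (hAB : IsControllablePair A B)
    {K : Matrix (Fin m) (Fin n) ℝ} {V : Matrix (Fin m) (Fin m) ℝ} (hV : V.PosDef)
    (hF : IsAsympStable (A - B * K)) :
    lyapunovPair (A - B * K) (B * V * Bᵀ) ∈ synthesisPairs A B := by
  have hVd := (Matrix.isUnit_iff_isUnit_det _).1 hV.isUnit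
  have h := mem_synthesisPairs_of_lyapunov hAB hV.inv hF (lyapunovSolution_spec hF _)
  rwa [Matrix.nonsing_inv_nonsing_inv _ hVd] at h

theorem isUnit_lyapunovSolution (hAB : IsControllablePair A B)
    {K : Matrix (Fin m) (Fin n) ℝ} {V : Matrix (Fin m) (Fin m) ℝ} (hV : V.PosDef)
    (hF : IsAsympStable (A - B * K)) : IsUnit (lyapunovSolution (A - B * K) (B * V * Bᵀ)) := by
  have hVd := (Matrix.isUnit_iff_isUnit_det _).1 hV.isUnit
  refine isUnit_of_lyapunov_of_isReachable hF (hAB.isReachable.feedback K) hV.inv ?_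
  rw [Matrix.nonsing_inv_nonsing_inv _ hVd]
  exact lyapunovSolution_spec hF _

/-- Every synthesis pair is parametrized by a stabilizing feedback `K` and `V = R⁻¹`. -/
theorem exists_lyapunovPair_of_mem_synthesisPairs
    {p : Matrix (Fin n) (Fin n) ℝ × Matrix (Fin n) (Fin n) ℝ} (hp : p ∈ synthesisPairs A B) :
    ∃ (K : Matrix (Fin m) (Fin n) ℝ) (V : Matrix (Fin m) (Fin m) ℝ), V.PosDef ∧
      IsAsympStable (A - B * K) ∧ p = lyapunovPair (A - B * K) (B * V * Bᵀ) := by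
  obtain ⟨K, R, X, hR, hF, hX, rfl⟩ := exists_lyapunov_of_mem_synthesisPairs hp
  refine ⟨K, R⁻¹, hR.inv, hF, ?_⟩
  rw [eq_lyapunovSolution hF hX]
  rfl

/-- Adding a small rank-one term `s v vᵀ` to `R⁻¹` makes the pair rigid, if `B v` is a cyclic
vector. -/
theorem eventually_isRigidPair (hAB : IsControllablePair A B)
    {K : Matrix (Fin m) (Fin n) ℝ} {V : Matrix (Fin m) (Fin m) ℝ} (hV : V.PosDef)
    (hF : IsAsympStable (A - B * K)) {v : Fin m → ℝ} (hv : B *ᵥ v ≠ 0)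
    (hcyc : IsCyclicVector (A - B * K) (B *ᵥ v)) :
    ∀ᶠ s in 𝓝[>] (0 : ℝ), (V + s • Matrix.vecMulVec v v).PosDef ∧
      IsRigidPair (A - B * K)
        (lyapunovPair (A - B * K) (B * (V + s • Matrix.vecMulVec v v) * Bᵀ)).2 := by
  set F := A - B * K with hFK
  set b := B *ᵥ v with hb
  have hBb : B * Matrix.vecMulVec v v * Bᵀ = Matrix.vecMulVec b b := by
    rw [Matrix.mul_vecMulVec, Matrix.vecMulVec_mul, Matrix.vecMul_transpose]
  obtain ⟨X₁, hX₁⟩ := exists_lyapunov hF (Matrix.vecMulVec b b)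
  set W₀ := B * V * Bᵀ with hW₀
  set X₀ := lyapunovSolution F W₀ with hX₀
  have hX₀' : F * X₀ + X₀ * Fᵀ = W₀ := lyapunovSolution_spec hF _
  have hX₁u : IsUnit X₁ := by
    refine isUnit_of_lyapunov hF ?_ hX₁ fun w hw => hcyc w fun k => ?_
    · exact Matrix.posSemidef_vecMulVec_self_star b
    · have h1 := hw k
      rw [Matrix.vecMulVec_mulVec] at h1
      have h2 : b ⬝ᵥ (Fᵀ ^ k *ᵥ w) = 0 := by
        have h3 := (smul_eq_zero.1 h1).resolve_right hv
        simpa using h3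
      rwa [← Matrix.transpose_pow, Matrix.mulVec_transpose, dotProduct_comm,
        ← Matrix.dotProduct_mulVec] at h2
  have hfin := finite_not_injective_add_smul (commutantSystem F W₀ X₀)
    (commutantSystem F (Matrix.vecMulVec b b) X₁) (commutantSystem_injective hv hcyc hX₁u)
  have hev : ∀ᶠ s in 𝓝[>] (0 : ℝ), s ∉ ({s : ℝ | ¬ Function.Injective (commutantSystem F W₀ X₀ +
      s • commutantSystem F (Matrix.vecMulVec b b) X₁)} \ {0}) :=
    nhdsWithin_le_nhds ((hfin.sdiff (t := {0})).isClosed.isOpen_compl.mem_nhds (by simp))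
  filter_upwards [hev, self_mem_nhdsWithin] with s hs hs0
  have hs0 : 0 < s := hs0
  have hinj : Function.Injective (commutantSystem F W₀ X₀ +
      s • commutantSystem F (Matrix.vecMulVec b b) X₁) := by
    by_contra hcon
    exact hs ⟨hcon, hs0.ne'⟩
  have hVs : (V + s • Matrix.vecMulVec v v).PosDef :=
    hV.add_posSemidef ((Matrix.posSemidef_vecMulVec_self_star v).smul hs0.le)
  refine ⟨hVs, ?_⟩
  have hWs : B * (V + s • Matrix.vecMulVec v v) * Bᵀ = W₀ + s • Matrix.vecMulVec b b := by
    rw [Matrix.mul_add, Matrix.add_mul, Matrix.mul_smul, Matrix.smul_mul, hBb]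
  have hXs : X₀ + s • X₁ = lyapunovSolution F (B * (V + s • Matrix.vecMulVec v v) * Bᵀ) := by
    apply eq_lyapunovSolution hF
    rw [hWs, ← hX₀', ← hX₁, Matrix.mul_add, Matrix.add_mul, Matrix.mul_smul, Matrix.smul_mul,
      smul_add]
    abel
  have hXu := isUnit_lyapunovSolution hAB hVs hF
  refine isRigidPair_of_injective hXu fun N hN => ?_
  rw [← hXs, hWs] at hN
  rw [injective_iff_map_eq_zero] at hinj
  -- the two equations which do not involve `(W, X)` occur in the sum with the factor `1 + s`
  refine hinj N ?_
  simp only [commutantSystem, LinearMap.coe_mk, AddHom.coe_mk, Prod.mk_eq_zero, LinearMap.add_apply,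
    LinearMap.smul_apply, Prod.smul_mk, Prod.mk_add_mk] at hN ⊢
  obtain ⟨h1, h2, h3, h4⟩ := hN
  refine ⟨by rw [h1, smul_zero, add_zero], ?_, ?_, by rw [h4, smul_zero, add_zero]⟩
  · rw [← h2]
    simp only [Matrix.mul_add, Matrix.add_mul, Matrix.mul_smul, Matrix.smul_mul, smul_sub]
    abel
  · rw [← h3]
    simp only [Matrix.mul_add, Matrix.add_mul, Matrix.mul_smul, Matrix.smul_mul, smul_sub]
    abel

/-- Every synthesis pair is a limit of rigid synthesis pairs: the feedback is perturbed first, so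
that a vector `B v` becomes cyclic, and then the inverse `V = R⁻¹` of the weight. -/
theorem exists_isRigidPair_mem (hAB : IsControllablePair A B)
    {p : Matrix (Fin n) (Fin n) ℝ × Matrix (Fin n) (Fin n) ℝ} (hp : p ∈ synthesisPairs A B)
    {O : Set (Matrix (Fin n) (Fin n) ℝ × Matrix (Fin n) (Fin n) ℝ)} (hO : IsOpen O) (hpO : p ∈ O) :
    ∃ q ∈ synthesisPairs A B, q ∈ O ∧ IsRigidPair q.1 q.2 := by
  rcases Nat.eq_zero_or_pos n with rfl | hn
  · exact ⟨p, hp, hpO, fun N _ _ _ => Subsingleton.elim _ _⟩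
  obtain ⟨K₀, V, hV, hF₀, rfl⟩ := exists_lyapunovPair_of_mem_synthesisPairs hp
  obtain ⟨v, hv⟩ : ∃ v, B *ᵥ v ≠ 0 := by
    by_contra! hB
    have h := hAB.isReachable (Pi.single ⟨0, hn⟩ 1) fun k => by
      refine dotProduct_eq_zero _ fun u => ?_
      rw [← Matrix.dotProduct_mulVec, ← Matrix.mulVec_mulVec, hB, Matrix.mulVec_zero,
        dotProduct_zero]
    have := congrFun h ⟨0, hn⟩
    simp at this
  obtain ⟨K, hKF, hKO, hKcyc⟩ : ∃ K : Matrix (Fin m) (Fin n) ℝ,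
      IsAsympStable (A - B * K) ∧ lyapunovPair (A - B * K) (B * V * Bᵀ) ∈ O ∧
      IsCyclicVector (A - B * K) (B *ᵥ v) := by
    obtain ⟨K₁, hK₁⟩ := exists_feedback_det_ne_zero (hAB.isReachable.feedback K₀) hv
    obtain ⟨q, hq⟩ := exists_polynomial_det (A - B * K₀) (-(B * K₁)) (B *ᵥ v)
    have hq0 : q ≠ 0 := by
      rintro rfl
      apply hK₁
      rw [sub_eq_add_neg (A - B * K₀), ← one_smul ℝ (-(B * K₁)), ← hq, Polynomial.eval_zero]
    have hFs : ∀ s : ℝ, A - B * K₀ + s • -(B * K₁) = A - B * (K₀ + s • K₁) := fun s => by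
      rw [Matrix.mul_add, Matrix.mul_smul, smul_neg]
      abel
    have hcont : Continuous fun s : ℝ => A - B * K₀ + s • -(B * K₁) := by fun_prop
    have h0 : A - B * K₀ + (0 : ℝ) • -(B * K₁) = A - B * K₀ := by simp
    have hst : ∀ᶠ s in 𝓝 (0 : ℝ), IsAsympStable (A - B * K₀ + s • -(B * K₁)) :=
      hcont.continuousAt.eventually (by beta_reduce; rw [h0]; exact hF₀.eventually)
    have hOs : ∀ᶠ s in 𝓝 (0 : ℝ),
        lyapunovPair (A - B * K₀ + s • -(B * K₁)) (B * V * Bᵀ) ∈ O := by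
      have hc : ContinuousAt
          (fun s : ℝ => lyapunovPair (A - B * K₀ + s • -(B * K₁)) (B * V * Bᵀ)) 0 := by
        refine ContinuousAt.comp (f := fun s : ℝ => (A - B * K₀ + s • -(B * K₁), B * V * Bᵀ))
          (g := fun q : Matrix (Fin n) (Fin n) ℝ × Matrix (Fin n) (Fin n) ℝ =>
            lyapunovPair q.1 q.2) ?_ (hcont.prodMk continuous_const).continuousAt
        rw [h0]
        exact continuousAt_lyapunovPair hF₀ (isUnit_lyapunovSolution hAB hV hF₀)
      refine hc.eventually (hO.mem_nhds ?_)
      beta_reduce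
      rw [h0]
      exact hpO
    obtain ⟨s, hs, hss, hsO⟩ := ((eventually_eval_ne_zero hq0).and
      ((hst.and hOs).filter_mono nhdsWithin_le_nhds)).exists
    rw [hFs] at hss hsO
    refine ⟨K₀ + s • K₁, hss, hsO, isCyclicVector_of_det_ne_zero ?_⟩
    rw [← hFs, ← hq]
    exact hs
  have hcont : Continuous fun s : ℝ =>
      (A - B * K, B * (V + s • Matrix.vecMulVec v v) * Bᵀ) := by fun_prop
  have h0 : B * (V + (0 : ℝ) • Matrix.vecMulVec v v) * Bᵀ = B * V * Bᵀ := by simp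
  have hOs : ∀ᶠ s in 𝓝 (0 : ℝ),
      lyapunovPair (A - B * K) (B * (V + s • Matrix.vecMulVec v v) * Bᵀ) ∈ O := by
    have hc : ContinuousAt (fun s : ℝ =>
        lyapunovPair (A - B * K) (B * (V + s • Matrix.vecMulVec v v) * Bᵀ)) 0 := by
      refine ContinuousAt.comp
        (f := fun s : ℝ => (A - B * K, B * (V + s • Matrix.vecMulVec v v) * Bᵀ))
        (g := fun q : Matrix (Fin n) (Fin n) ℝ × Matrix (Fin n) (Fin n) ℝ =>
          lyapunovPair q.1 q.2) ?_ hcont.continuousAt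
      rw [h0]
      exact continuousAt_lyapunovPair hKF (isUnit_lyapunovSolution hAB hV hKF)
    refine hc.eventually (hO.mem_nhds ?_)
    beta_reduce
    rw [h0]
    exact hKO
  obtain ⟨s, ⟨hVs, hrig⟩, hsO⟩ := ((eventually_isRigidPair hAB hV hKF hv hKcyc).and
    (hOs.filter_mono nhdsWithin_le_nhds)).exists
  exact ⟨_, lyapunovPair_mem_synthesisPairs hAB hVs hKF, hsO, hrig⟩

end

end LQ

theorem mainTheorem5 {n m : ℕ} (A : Matrix (Fin n) (Fin n) ℝ) (B : Matrix (Fin n) (Fin m) ℝ)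
    (hAB : LQ.IsControllablePair A B) :
    (∃ U : Set (LQ.synthesisPairs A B), IsOpen U ∧ Dense U ∧
      ∀ p ∈ U, (p : Matrix (Fin n) (Fin n) ℝ × Matrix (Fin n) (Fin n) ℝ) ∈
        LQ.synthesisPairs A B \ LQ.productPairs A B) ∧
    (∀ (Q : Matrix (Fin n) (Fin n) ℝ) (S : Matrix (Fin n) (Fin m) ℝ)
      (R : Matrix (Fin m) (Fin m) ℝ) (p : Matrix (Fin n) (Fin n) ℝ × Matrix (Fin n) (Fin n) ℝ),
      LQ.IsAdmissibleCost A B Q S R → LQ.IsSynthesisPair A B Q S R p.1 p.2 →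
      p ∈ LQ.synthesisPairs A B \ LQ.productPairs A B →
      ∃! d : Matrix (Fin m) (Fin n) ℝ × Matrix (Fin m) (Fin m) ℝ,
        LQ.IsCanonical A B d.1 d.2 ∧
        LQ.optimalSynthesis A B (LQ.canonicalCost d.1 d.2) =
          LQ.optimalSynthesis A B (LQ.quadraticCost Q S R)) := by
  refine ⟨⟨Subtype.val ⁻¹' {p | LQ.IsRigidPair p.1 p.2},
    LQ.isOpen_isRigidPair.preimage continuous_subtype_val, ?_, ?_⟩, ?_⟩
  · rw [dense_iff_inter_open]
    rintro _ ⟨O, hO, rfl⟩ ⟨p, hp⟩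
    obtain ⟨q, hq, hqO, hqr⟩ := LQ.exists_isRigidPair_mem hAB p.2 hO hp
    exact ⟨⟨q, hq⟩, hqO, hqr⟩
  · exact fun p hp => ⟨p.2, LQ.IsRigidPair.notMem_productPairs hp⟩
  · exact fun Q S R p hc hp hpJ => LQ.existsUnique_canonical hAB hc hp hpJ
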